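/- **Conventions.** Functions $\mathbb R\to\mathbb C$ are graded by $\alpha(f)(x)=f(-x)$; $\partial a\in\{0,1\}$ is the degree of a homogeneous function $a$ ($0$ if even, $1$ if odd). Tensors $a_0\otimes\dots\otimes a_n$ are identified with the functions $a_0(x_0)\cdots a_n(x_n)$ on $\mathbb R^{n+1}$. For $m\in\mathbb N$ let $\Sigma^{(m)}$ be the Fréchet space of smooth $f:\mathbb R\to\mathbb C$ with $\sup_x|f^{(k)}(x)|(1+|x|)^{k-m}<\infty$ for all $k\ge 0$, and for $\epsilon>0$ let $\mathcal D_\epsilon$ be the Fréchet space of smooth $f$ with $\int_{\mathbb R}e^{\epsilon x^2}|f^{(k)}(x)|^2dx<\infty$ for all $k\ge 0$. Let $\mathcal F^{(n)}\subset C^\infty(\mathbb R^{n+1})$ be the sum, over all $k\in\{0,\dots,n\}$ and all $m_0,\dots,m_n\in\mathbb N$ with $m_k\ge 1$, of the images of the completed projective tensor products of $n+1$ factors, of which the $k$-th is $\mathcal D_{1/m_k}$ and the $j$-th is $\Sigma^{(m_j)}$ for $j\ne k$. For homogeneous $a_j$ put $$b(a_0\otimes\dots\otimes a_{n+1})=\sum_{k=0}^{n}(-1)^k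 a_0\otimes\dots\otimes a_ka_{k+1}\otimes\dots\otimes a_{n+1}+(-1)^{n+1+\nu}a_{n+1}a_0\otimes a_1\otimes\dots\otimes a_n,$$ with $\nu=\partial a_{n+1}(\partial a_0+\dots+\partial a_n)$, and $$\mathbf t_n(a_0\otimes\dots\otimes a_n)=(-1)^{n+\nu}a_n\otimes a_0\otimes\dots\otimes a_{n-1},\qquad \nu=\partial a_n(\partial a_0+\dots+\partial a_{n-1});$$ both are extended linearly and continuously to functions of several variables. Connes' cyclic complex is $(\mathcal F^{(n)}/(1-\mathbf t_n)\mathcal F^{(n)},b)_{n\ge 0}$. **Combinatorial data.** Let $S_n$ be the set of all $K\subset\{0,\dots,n\}$ with $0,n\in K$ whose complement contains no two consecutive integers, and let $L(K)=\{p\in K: p+1\in K\}$. Let $C_n$ be the set of pairs $(K,\sigma)$, $K\in S_n$, $\sigma=\sigma_0\cdots\sigma_{n-1}\in\{0,1\}^n$, modulo $(K,\sigma)\simeq(K,\sigma')$ if $\sigma_p=\sigma'_p$ for all $p\in L(K)$; $C_{-1}=\emptyset$. For $0\le p\le n$ let $i_p=j_p+k_p$, where $j_p=1$ if $p-1,p\in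 K$ and $\sigma_{p-1}=1$, and $j_p=0$ otherwise; $k_p=1$ if $p,p+1\in K$ and $\sigma_p=0$, and $k_p=0$ otherwise. Define $\nu_K$ for $K\in S_n$ by $\nu_{\{0\}}=0$ and, for $n\ge1$, $\nu_K=\nu_{(K\setminus\{0\})-1}+n+1$ if $1\in K$ and $\nu_K=\nu_{(K\setminus\{0\})-2}+1$ if $1\notin K$. Put $|(K,\sigma)|=\sum_{p\in L(K)}\sigma_p+\nu_K$. **Chains.** For $t\ge0$ and $(K,\sigma)\in C_n$ let $$\chi_{K,\sigma}(t)=(-1)^{|(K,\sigma)|}\int_{t\Delta_K}e^{-t_0x^2}x^{i_0}\otimes\dots\otimes e^{-t_nx^2}x^{i_n}\,dV,$$ where $t\Delta_K=\{(t_0,\dots,t_n): t_p\ge0,\ \sum t_p=t,\ t_p=0\text{ for }p\notin K\}$ and $dV$ is normalized so that $t\Delta_K$ has volume $t^{d}/d!$, $d=|K|-1$. Similarly let $$\tilde\chi_{K,\sigma}(t)=(-1)^{|(K,\sigma)|}\int_{t\Delta_{\{-1\}\cup K}}e^{-t_{-1}x^2}\otimes e^{-t_0x^2}x^{i_0}\otimes\dots\otimes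 e^{-t_nx^2}x^{i_n}\,dV,$$ where $t\Delta_{\{-1\}\cup K}$ is the analogous simplex in the coordinates $t_{-1},t_0,\dots,t_n$, of volume $t^{|K|}/|K|!$. Put $$\psi_n(t)=\sum_{(K,\sigma)\in C_n}\chi_{K,\sigma}(t),\qquad \tilde\psi_n(t)=\sum_{(K,\sigma)\in C_{n-1}}\tilde\chi_{K,\sigma}(t).$$ **Theorem.** For all $n\ge0$ and $t>0$, $\psi_n(t)$ defines an $n$-cycle in Connes' cyclic complex: $\psi_n(t)\in\mathcal F^{(n)}$ and, if $n\ge1$, $b(\psi_n(t))\in(1-\mathbf t_{n-1})\mathcal F^{(n-1)}$. More precisely, for all $n\ge 0$ and $t\ge 0$: (i) $b(\psi_{n+1}(t))=-\tilde\psi_n(t)$; (ii) $\tilde\psi_n(t)\in(1-\mathbf t_n)\mathcal F^{(n)}$. -/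

import Mathlib

open Filter Topology MeasureTheory
open scoped ENNReal ContDiff

noncomputable section

namespace CyclicHeat

/-- Functions of `n + 1` real variables: the space in which the `n`-chains live. The factor
number `j` of a tensor `a_0 ⊗ ... ⊗ a_n` depends on the variable `x j`. -/
abbrev Fun (n : ℕ) : Type := (Fin (n + 1) → ℝ) → ℂ

/-- The elementary tensor `a_0 ⊗ ... ⊗ a_{N-1}` as a function of `N` variables. -/
def tensor {N : ℕ} (a : Fin N → ℝ → ℂ) : (Fin N → ℝ) → ℂ := fun x => ∏ j, a j (x j)

/-! ### The Hochschild boundary and the cyclic operator of the graded algebra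

Functions on the line are graded by `α(f)(x) = f(-x)`. The formulas on elementary tensors are
extended to all functions of several variables by splitting a function into its even and its
odd part in the last variable. -/

/-- Moves the last tensor factor to the front, with the sign rule: for homogeneous `a_j`
the value is `(-1)^ν a_n(z) a_0(y_0) ... a_{n-1}(y_{n-1})`, with
`ν = ∂a_n (∂a_0 + ... + ∂a_{n-1})`. -/
def koszul {n : ℕ} (f : Fun n) (y : Fin n → ℝ) (z : ℝ) : ℂ :=
  (f (Fin.snoc y z) + f (Fin.snoc y (-z))) / 2 +
    (f (Fin.snoc (-y) z) - f (Fin.snoc (-y) (-z))) / 2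

/-- The graded Hochschild boundary
`b(a_0 ⊗ ... ⊗ a_{n+1}) = ∑_{k ≤ n} (-1)^k a_0 ⊗ ... ⊗ a_k a_{k+1} ⊗ ... ⊗ a_{n+1}
  + (-1)^{n+1+ν} a_{n+1} a_0 ⊗ a_1 ⊗ ... ⊗ a_n`. -/
def hochschild (n : ℕ) : Fun (n + 1) →ₗ[ℂ] Fun n where
  toFun f := fun x =>
    ∑ k : Fin (n + 1), (-1) ^ (k : ℕ) * f (x ∘ k.predAbove) + (-1) ^ (n + 1) * koszul f x (x 0)
  map_add' f g := by
    funext x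
    simp only [Pi.add_apply, koszul, mul_add, Finset.sum_add_distrib]
    ring
  map_smul' c f := by
    funext x
    simp only [Pi.smul_apply, smul_eq_mul, koszul, RingHom.id_apply, mul_add, Finset.mul_sum]
    congr 1
    · exact Finset.sum_congr rfl fun k _ => by ring
    · ring

/-- The cyclic operator
`t_n(a_0 ⊗ ... ⊗ a_n) = (-1)^{n+ν} a_n ⊗ a_0 ⊗ ... ⊗ a_{n-1}`. -/
def cyc (n : ℕ) : Fun n →ₗ[ℂ] Fun n where
  toFun f := fun x => (-1) ^ n * koszul f (Fin.tail x) (x 0)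
  map_add' f g := by
    funext x
    simp only [Pi.add_apply, koszul]
    ring
  map_smul' c f := by
    funext x
    simp only [Pi.smul_apply, smul_eq_mul, koszul, RingHom.id_apply]
    ring

/-- `f` is homogeneous of degree `d` modulo `2`. -/
def HasDegree (f : ℝ → ℂ) (d : ℕ) : Prop := ∀ x, f (-x) = (-1) ^ d * f x

theorem koszul_tensor {n : ℕ} (a : Fin (n + 1) → ℝ → ℂ) (d : Fin (n + 1) → ℕ)
    (h : ∀ j, HasDegree (a j) (d j)) (y : Fin n → ℝ) (z : ℝ) :
    koszul (tensor a) y z = (-1) ^ (d (Fin.last n) * ∑ j : Fin n, d j.castSucc) *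
      (a (Fin.last n) z * ∏ j : Fin n, a j.castSucc (y j)) := by
  have e : ∏ j : Fin n, a j.castSucc (-y j) =
      (-1) ^ (∑ j : Fin n, d j.castSucc) * ∏ j : Fin n, a j.castSucc (y j) := by
    rw [← Finset.prod_pow_eq_pow_sum, ← Finset.prod_mul_distrib]
    exact Finset.prod_congr rfl fun j _ => h _ _
  simp only [koszul, tensor, Fin.prod_univ_castSucc, Fin.snoc_castSucc, Fin.snoc_last,
    Pi.neg_apply, e, h (Fin.last n) z]
  rcases neg_one_pow_eq_or ℂ (d (Fin.last n)) with hd | hd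
  · rw [pow_mul, hd]; simp; ring
  · rw [pow_mul, hd]; ring

theorem cyc_tensor {n : ℕ} (a : Fin (n + 1) → ℝ → ℂ) (d : Fin (n + 1) → ℕ)
    (h : ∀ j, HasDegree (a j) (d j)) :
    cyc n (tensor a) = (-1 : ℂ) ^ (n + d (Fin.last n) * ∑ j : Fin n, d j.castSucc) •
      tensor (Fin.cons (a (Fin.last n)) (Fin.init a) : Fin (n + 1) → ℝ → ℂ) := by
  funext x
  simp only [cyc, LinearMap.coe_mk, AddHom.coe_mk, koszul_tensor a d h, Pi.smul_apply, smul_eq_mul,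
    tensor, Fin.prod_univ_succ, Fin.cons_zero, Fin.cons_succ, Fin.init, Fin.tail, pow_add]
  ring

theorem hochschild_tensor {n : ℕ} (a : Fin (n + 2) → ℝ → ℂ) (d : Fin (n + 2) → ℕ)
    (h : ∀ j, HasDegree (a j) (d j)) :
    hochschild n (tensor a) =
      ∑ k : Fin (n + 1), (-1 : ℂ) ^ (k : ℕ) •
        tensor (fun j y => ∏ i with k.predAbove i = j, a i y) +
      (-1 : ℂ) ^ (n + 1 + d (Fin.last (n + 1)) * ∑ j : Fin (n + 1), d j.castSucc) •
        tensor (Fin.cons (a (Fin.last (n + 1)) * a 0) (fun j => a j.succ.castSucc) :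
          Fin (n + 1) → ℝ → ℂ) := by
  funext x
  simp only [hochschild, LinearMap.coe_mk, AddHom.coe_mk, koszul_tensor a d h, Pi.smul_apply,
    smul_eq_mul, Pi.add_apply, Finset.sum_apply]
  congr 1
  · refine Finset.sum_congr rfl fun k _ => ?_
    congr 1
    simp only [tensor, Function.comp]
    rw [← Finset.prod_fiberwise Finset.univ (fun i => k.predAbove i)]
    refine Finset.prod_congr rfl fun j _ => Finset.prod_congr rfl fun i hi => ?_
    rw [(Finset.mem_filter.1 hi).2]
  · rw [Fin.prod_univ_succ (n := n)]
    simp only [tensor, Fin.prod_univ_succ, Fin.cons_zero, Fin.cons_succ, Pi.mul_apply, pow_add,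
      Fin.castSucc_zero]
    ring

/-! ### The spaces `𝓕^(n)` -/

/-- The (increasing in `N`) seminorms of the space `Σ^(m)` of symbols of order `m`. -/
def symbolSeminorm (m N : ℕ) (f : ℝ → ℂ) : ℝ≥0∞ :=
  ∑ k ∈ Finset.range (N + 1),
    ⨆ x : ℝ, ‖iteratedDeriv k f x‖ₑ * ENNReal.ofReal ((1 + |x|) ^ ((k : ℤ) - (m : ℤ)))

/-- The (increasing in `N`) seminorms of the space `𝓓_{1/m}`, `m ≥ 1`. -/
def decaySeminorm (m N : ℕ) (f : ℝ → ℂ) : ℝ≥0∞ :=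
  ∑ k ∈ Finset.range (N + 1),
    (∫⁻ x : ℝ, ENNReal.ofReal (Real.exp (1 / (m : ℝ) * x ^ 2)) * ‖iteratedDeriv k f x‖ₑ ^ 2)
      ^ (1 / 2 : ℝ)

/-- The seminorms of the factor number `j` in
`Σ^(m_0) ⊗ ... ⊗ 𝓓_{1/m_k} ⊗ ... ⊗ Σ^(m_n)`. -/
def slotSeminorm {n : ℕ} (k : Fin (n + 1)) (m : Fin (n + 1) → ℕ) (N : ℕ) (j : Fin (n + 1))
    (f : ℝ → ℂ) : ℝ≥0∞ :=
  if j = k then decaySeminorm (m j) N f else symbolSeminorm (m j) N f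

/-- The factor number `j` in `Σ^(m_0) ⊗ ... ⊗ 𝓓_{1/m_k} ⊗ ... ⊗ Σ^(m_n)`: it is `𝓓_{1/m_k}`
for `j = k`, and `Σ^(m_j)` otherwise. -/
def slotSpace {n : ℕ} (k : Fin (n + 1)) (m : Fin (n + 1) → ℕ) (j : Fin (n + 1)) :
    Set (ℝ → ℂ) :=
  {f | ContDiff ℝ ∞ f ∧ ∀ N, slotSeminorm k m N j f < ⊤}

/-- The projective tensor product seminorms on the algebraic tensor product
`Σ^(m_0) ⊗ ... ⊗ 𝓓_{1/m_k} ⊗ ... ⊗ Σ^(m_n)`, realised as a space of functions: the infimum over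
all representations as a finite sum of elementary tensors. -/
def projSeminorm {n : ℕ} (k : Fin (n + 1)) (m : Fin (n + 1) → ℕ) (N : ℕ) (g : Fun n) : ℝ≥0∞ :=
  ⨅ (l : List (Fin (n + 1) → ℝ → ℂ)) (_ : ∀ u ∈ l, ∀ j, u j ∈ slotSpace k m j)
    (_ : (l.map tensor).sum = g), (l.map fun u => ∏ j, slotSeminorm k m N j (u j)).sum

theorem symbolSeminorm_smul_le (m N : ℕ) (c : ℂ) (f : ℝ → ℂ) :
    symbolSeminorm m N (c • f) ≤ ‖c‖ₑ * symbolSeminorm m N f := by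
  unfold symbolSeminorm
  rw [Finset.mul_sum]
  refine Finset.sum_le_sum fun k _ => iSup_le fun x => ?_
  rw [iteratedDeriv_const_smul_field, enorm_smul, mul_assoc]
  gcongr
  exact le_iSup (fun x : ℝ => ‖iteratedDeriv k f x‖ₑ *
    ENNReal.ofReal ((1 + |x|) ^ ((k : ℤ) - (m : ℤ)))) x

theorem decaySeminorm_smul_le (m N : ℕ) (c : ℂ) (f : ℝ → ℂ) :
    decaySeminorm m N (c • f) ≤ ‖c‖ₑ * decaySeminorm m N f := by
  unfold decaySeminorm
  rw [Finset.mul_sum]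
  refine Finset.sum_le_sum fun k _ => le_of_eq ?_
  have e : ∀ x : ℝ, ENNReal.ofReal (Real.exp (1 / (m : ℝ) * x ^ 2)) *
      ‖iteratedDeriv k (c • f) x‖ₑ ^ 2 = ‖c‖ₑ ^ 2 *
      (ENNReal.ofReal (Real.exp (1 / (m : ℝ) * x ^ 2)) * ‖iteratedDeriv k f x‖ₑ ^ 2) := by
    intro x
    rw [iteratedDeriv_const_smul_field, enorm_smul]
    ring
  simp only [e]
  rw [lintegral_const_mul' _ _ (by finiteness), ENNReal.mul_rpow_of_nonneg _ _ (by norm_num),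
    ← ENNReal.rpow_natCast, ← ENNReal.rpow_mul]
  norm_num

theorem slotSeminorm_smul_le {n : ℕ} (k : Fin (n + 1)) (m : Fin (n + 1) → ℕ) (N : ℕ)
    (j : Fin (n + 1)) (c : ℂ) (f : ℝ → ℂ) :
    slotSeminorm k m N j (c • f) ≤ ‖c‖ₑ * slotSeminorm k m N j f := by
  unfold slotSeminorm
  split_ifs
  · exact decaySeminorm_smul_le _ _ _ _
  · exact symbolSeminorm_smul_le _ _ _ _

theorem projSeminorm_add_le {n : ℕ} (k : Fin (n + 1)) (m : Fin (n + 1) → ℕ) (N : ℕ)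
    (g h : Fun n) :
    projSeminorm k m N (g + h) ≤ projSeminorm k m N g + projSeminorm k m N h := by
  unfold projSeminorm
  simp only [ENNReal.iInf_add, ENNReal.add_iInf]
  refine le_iInf fun l => le_iInf fun hl => le_iInf fun hg => le_iInf fun l' => le_iInf fun hl' =>
    le_iInf fun hh => ?_
  refine iInf_le_of_le (l' ++ l) (iInf_le_of_le ?_ (iInf_le_of_le ?_ ?_))
  · intro u hu
    rcases List.mem_append.1 hu with hu | hu
    · exact hl' u hu
    · exact hl u hu
  · simp [hg, hh]
  · simp [add_comm]

theorem smul_mem_slotSpace {n : ℕ} {k : Fin (n + 1)} {m : Fin (n + 1) → ℕ} {j : Fin (n + 1)}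
    (c : ℂ) {f : ℝ → ℂ} (hf : f ∈ slotSpace k m j) : c • f ∈ slotSpace k m j :=
  ⟨hf.1.const_smul c, fun N => (slotSeminorm_smul_le k m N j c f).trans_lt
    (ENNReal.mul_lt_top (by finiteness) (hf.2 N))⟩

theorem tensor_update_smul {n : ℕ} (k : Fin (n + 1)) (c : ℂ) (u : Fin (n + 1) → ℝ → ℂ) :
    tensor (Function.update u k (c • u k)) = c • tensor u := by
  funext x
  have e : ∀ j, Function.update u k (c • u k) j (x j) =
      Function.update (fun j => u j (x j)) k (c * u k (x k)) j := by
    intro j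
    by_cases hj : j = k
    · subst hj; simp
    · simp [hj]
  simp only [tensor, e, Pi.smul_apply, smul_eq_mul]
  rw [Finset.prod_update_of_mem (Finset.mem_univ k),
    ← Finset.mul_prod_erase Finset.univ (fun j => u j (x j)) (Finset.mem_univ k), mul_assoc,
    Finset.sdiff_singleton_eq_erase]

theorem projSeminorm_zero {n : ℕ} (k : Fin (n + 1)) (m : Fin (n + 1) → ℕ) (N : ℕ) :
    projSeminorm k m N 0 = 0 := by
  refine le_antisymm ?_ bot_le
  exact iInf_le_of_le [] (iInf_le_of_le (by simp) (iInf_le_of_le (by simp) (by simp)))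

theorem projSeminorm_smul_le {n : ℕ} (k : Fin (n + 1)) (m : Fin (n + 1) → ℕ) (N : ℕ)
    (c : ℂ) (g : Fun n) :
    projSeminorm k m N (c • g) ≤ ‖c‖ₑ * projSeminorm k m N g := by
  by_cases hc : c = 0
  · simp [hc, projSeminorm_zero]
  have h0 : ‖c‖ₑ ≠ 0 := by simpa using hc
  have h1 : ‖c‖ₑ ≠ ⊤ := by finiteness
  unfold projSeminorm
  simp only [ENNReal.mul_iInf_of_ne h0 h1]
  refine le_iInf fun l => le_iInf fun hl => le_iInf fun hg => ?_
  refine iInf_le_of_le (l.map fun u => Function.update u k (c • u k))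
    (iInf_le_of_le ?_ (iInf_le_of_le ?_ ?_))
  · intro v hv j
    obtain ⟨u, hu, rfl⟩ := List.mem_map.1 hv
    by_cases hj : j = k
    · subst hj
      simpa using smul_mem_slotSpace c (hl u hu j)
    · simpa [hj] using hl u hu j
  · rw [List.map_map, ← hg, List.smul_sum, List.map_map]
    congr 2
    funext u
    exact tensor_update_smul k c u
  · rw [List.map_map, ← List.sum_map_mul_left]
    refine List.sum_le_sum fun u _ => ?_
    simp only [Function.comp]
    rw [← Finset.mul_prod_erase Finset.univ _ (Finset.mem_univ k),
      ← Finset.mul_prod_erase Finset.univ (fun j => slotSeminorm k m N j (u j))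
        (Finset.mem_univ k), ← mul_assoc]
    refine mul_le_mul' ?_ (le_of_eq ?_)
    · simpa using slotSeminorm_smul_le k m N k c (u k)
    · refine Finset.prod_congr rfl fun j hj => ?_
      rw [Function.update_of_ne (Finset.ne_of_mem_erase hj)]

/-- The image in the functions of `n + 1` variables of the completed projective tensor product
`𝓕_k(m_0, ..., m_n) = Σ^(m_0) ⊗ ... ⊗ 𝓓_{1/m_k} ⊗ ... ⊗ Σ^(m_n)`. The factors are metrizable, so
an element of the completion is given by a Cauchy sequence of the algebraic tensor product, and
its image is the pointwise limit of that sequence. -/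
def completedTensor {n : ℕ} (k : Fin (n + 1)) (m : Fin (n + 1) → ℕ) : Submodule ℂ (Fun n) where
  carrier := {f | ∃ g : ℕ → Fun n,
    (∀ i, g i ∈ Submodule.span ℂ {h | ∃ u, (∀ j, u j ∈ slotSpace k m j) ∧ h = tensor u}) ∧
    (∀ N, Tendsto (fun p : ℕ × ℕ => projSeminorm k m N (g p.1 - g p.2)) atTop (𝓝 0)) ∧
    ∀ x, Tendsto (fun i => g i x) atTop (𝓝 (f x))}
  zero_mem' := ⟨0, fun _ => Submodule.zero_mem _, fun N => by simp [projSeminorm_zero],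
    fun x => by simp⟩
  add_mem' := by
    rintro f f' ⟨g, h1, h2, h3⟩ ⟨g', h1', h2', h3'⟩
    refine ⟨g + g', fun i => Submodule.add_mem _ (h1 i) (h1' i), fun N => ?_,
      fun x => (h3 x).add (h3' x)⟩
    refine tendsto_of_tendsto_of_tendsto_of_le_of_le tendsto_const_nhds
      (by simpa using (h2 N).add (h2' N)) (fun _ => bot_le) fun p => ?_
    have e : (g + g') p.1 - (g + g') p.2 = (g p.1 - g p.2) + (g' p.1 - g' p.2) := by
      simp only [Pi.add_apply]; abel
    simp only [e]
    exact projSeminorm_add_le _ _ _ _ _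
  smul_mem' := by
    rintro c f ⟨g, h1, h2, h3⟩
    refine ⟨c • g, fun i => Submodule.smul_mem _ _ (h1 i), fun N => ?_,
      fun x => (h3 x).const_smul c⟩
    refine tendsto_of_tendsto_of_tendsto_of_le_of_le tendsto_const_nhds
      (by simpa using ENNReal.Tendsto.const_mul (a := ‖c‖ₑ) (h2 N) (Or.inr (by finiteness)))
      (fun _ => bot_le) fun p => ?_
    have e : (c • g) p.1 - (c • g) p.2 = c • (g p.1 - g p.2) := by
      simp only [Pi.smul_apply, smul_sub]
    simp only [e]
    exact projSeminorm_smul_le _ _ _ _ _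

/-- `𝓕^(n) = ∑_k 𝓕_k^(n)`, where `𝓕_k^(n)` is the union over all `m` of the (images of the)
spaces `𝓕_k(m_0, ..., m_n)`. -/
def F (n : ℕ) : Submodule ℂ (Fun n) :=
  ⨆ (k : Fin (n + 1)) (m : Fin (n + 1) → ℕ) (_ : 0 < m k), completedTensor k m

/-- The subspace `(1 - t_n) 𝓕^(n)`. -/
def oneSubCyc (n : ℕ) : Submodule ℂ (Fun n) := (F n).map (LinearMap.id - cyc n)

/-- `f` represents an `n`-cycle of Connes' cyclic complex `(𝓕^(n) / (1 - t_n) 𝓕^(n), b)`. -/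
def IsCyclicCycle : (n : ℕ) → Fun n → Prop
  | 0, f => f ∈ F 0
  | n + 1, f => f ∈ F (n + 1) ∧ hochschild n f ∈ oneSubCyc n

/-! ### The combinatorial data -/

/-- The set `S_n` of all `K ⊆ {0, ..., n}` that contain `0` and `n` and whose complement contains
no two consecutive integers. -/
def S (n : ℕ) : Finset (Finset ℕ) :=
  (Finset.range (n + 1)).powerset.filter fun K =>
    0 ∈ K ∧ n ∈ K ∧ ∀ p < n, p ∈ K ∨ p + 1 ∈ K

/-- `L(K)`, the set of all `p ∈ K` with `p + 1 ∈ K`. -/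
def L (K : Finset ℕ) : Finset ℕ := K.filter fun p => p + 1 ∈ K

/-- The set `C_n` of classes of pairs `(K, σ)`, with `K ∈ S_n` and `σ ∈ {0,1}^n`, two pairs being
equivalent if they have the same `K` and the strings agree on `L(K)`. A string `σ` is given by
the set `A = {p : σ_p = 1}`, and a class by its only member with `A ⊆ L(K)`. -/
def C (n : ℕ) : Finset (Finset ℕ × Finset ℕ) :=
  (S n ×ˢ (Finset.range n).powerset).filter fun c => c.2 ⊆ L c.1

/-- The exponent `i_p = j_p + k_p` attached to `(K, σ)`. -/
def expo (K A : Finset ℕ) (p : ℕ) : ℕ :=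
  (if 1 ≤ p ∧ p - 1 ∈ K ∧ p ∈ K ∧ p - 1 ∈ A then 1 else 0) +
    (if p ∈ K ∧ p + 1 ∈ K ∧ p ∉ A then 1 else 0)

/-- The exponents depend only on the class of `(K, σ)`. -/
theorem expo_inter_L (K A : Finset ℕ) (p : ℕ) : expo K (A ∩ L K) p = expo K A p := by
  unfold expo L
  congr 1
  · refine if_congr ?_ rfl rfl
    rcases p with _ | p
    · simp
    · simp only [Finset.mem_inter, Finset.mem_filter, Nat.add_sub_cancel]; tauto
  · refine if_congr ?_ rfl rfl
    simp only [Finset.mem_inter, Finset.mem_filter]; tauto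

/-- `ν_K` for `K ∈ S_n`, by recursion on `n`. -/
def nu : ℕ → Finset ℕ → ℕ
  | 0, _ => 0
  | 1, K => nu 0 ((K.erase 0).image (· - 1)) + 2
  | n + 2, K =>
    if 1 ∈ K then nu (n + 1) ((K.erase 0).image (· - 1)) + (n + 3)
    else nu n ((K.erase 0).image (· - 2)) + 1

/-- `|(K, σ)| = ∑_{p ∈ L(K)} σ_p + ν_K`. -/
def deg (n : ℕ) (K A : Finset ℕ) : ℕ := (L K ∩ A).card + nu n K

/-! ### The chains -/

/-- The integral of `g` over the simplex `t Δ_K`, the set of all `(t_0, ..., t_n)` with `t_p ≥ 0`,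
`t_0 + ... + t_n = t` and `t_p = 0` for `p ∉ K`, for `n ∈ K`. The volume is Lebesgue measure in the
coordinates `t_p`, `p ∈ K`, `p < n`, so that `t Δ_K` has volume `t ^ d / d!` for `d = |K| - 1`. -/
def simplexIntegral (n : ℕ) (K : Finset ℕ) (t : ℝ) (g : (Fin (n + 1) → ℝ) → ℂ) : ℂ :=
  ∫ s in {s : Fin n → ℝ | (∀ p, 0 ≤ s p) ∧ ∑ p, s p ≤ t},
    g (Fin.snoc s (t - ∑ p, s p))
    ∂(Measure.pi fun p : Fin n => if (p : ℕ) ∈ K then (volume : Measure ℝ) else Measure.dirac 0)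

/-- The function `e^{-s x²} x^i`. -/
def heat (s : ℝ) (i : ℕ) (x : ℝ) : ℂ := ((Real.exp (-(s * x ^ 2)) * x ^ i : ℝ) : ℂ)

/-- `χ_{K,σ}(t) = (-1)^{|(K,σ)|} ∫_{tΔ_K} e^{-t_0 x²} x^{i_0} ⊗ ... ⊗ e^{-t_n x²} x^{i_n} dV`. -/
def chi (n : ℕ) (K A : Finset ℕ) (t : ℝ) : Fun n := fun x =>
  (-1) ^ deg n K A *
    simplexIntegral n K t fun s => tensor (fun p => heat (s p) (expo K A p)) x

/-- `ψ_n(t)`, the sum of all `χ_{K,σ}(t)` over `C_n`. -/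
def psi (n : ℕ) (t : ℝ) : Fun n := ∑ c ∈ C n, chi n c.1 c.2 t

/-- For `(K,σ) ∈ C_n`, the chain
`(-1)^{|(K,σ)|} ∫ e^{-t_{-1} x²} ⊗ e^{-t_0 x²} x^{i_0} ⊗ ... ⊗ e^{-t_n x²} x^{i_n} dV`, the integral
being over `t Δ_{{-1} ∪ K}`. Indices are shifted by one, so that `-1` becomes `0`. -/
def chiTilde (n : ℕ) (K A : Finset ℕ) (t : ℝ) : Fun (n + 1) := fun x =>
  (-1) ^ deg n K A *
    simplexIntegral (n + 1) (insert 0 (K.image (· + 1))) t fun s =>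
      tensor (Fin.cons (heat (s 0) 0) (fun p : Fin (n + 1) => heat (s p.succ) (expo K A p)) :
        Fin (n + 2) → ℝ → ℂ) x

/-- `ψ̃_n(t)`, the sum of the chains `χ̃_{K,σ}(t)` over `C_{n-1}`; the set `C_{-1}` is empty. -/
def psiTilde : (n : ℕ) → ℝ → Fun n
  | 0, _ => 0
  | n + 1, t => ∑ c ∈ C n, chiTilde n c.1 c.2 t

end CyclicHeat

end

/-!
Why the theorem holds. Put `f_i = (-1)^i x_i`. At a point `x`, the chain `ψ_n(t)` is the contour
integral

  `ψ_n(t)(x) = -(2πi)⁻¹ ∮ e^{-t z²} ∏_i 1 / (f_i - z) dz`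

over a circle around all `± x_i` (`psi_eq_contour`); up to sign this is the divided difference of
`z ↦ e^{-t z²}` at the points `f_0, ..., f_n`. Indeed, integrating over the first simplex coordinate
last turns the combinatorial definition into a recursion (`psi_succ_succ_apply`): `ψ_{n+2}(t)` is
the convolution in `t` of `e^{-t x_0²}` with
`± (x_0 - x_1) ψ_{n+1}(t)(x_1, ...) - ψ_n(t)(x_2, ...)`, the two terms coming from the `K` that do
or do not contain `1`. Under the contour integral this convolution is the division by `x_0² - z²`
(`integral_heat_mul_contour`), so the products of simple poles obey the same recursion
(`integral_heat_mul_contour_poles`). In the same way `ψ̃_n(t)(x)` is, up to sign, the contour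
integral of `1 / (f_0² - z²) · ∏_{i > 0} 1 / (f_i - z)` (`psiTilde_eq_contour`).

With `a_i = 1 / (f_i - z)` and `b_i = 1 / (f_i + z)` one has `2z a_j b_j = a_j - b_j`, hence
`2z ∑_j b_0 ⋯ b_{j-1} (a_j b_j) a_{j+1} ⋯ a_n = ∏ a_i - ∏ b_i` by telescoping. The right side is an
odd function of `z`, so the sum is even and its contour integral vanishes
(`sum_contour_mixedPoles`). This single identity is used twice.

* The products of neighbouring factors in `b(ψ_{n+1}(t))` give exactly these summands (with `a` and
  `b` exchanged, which only changes the sign), so they cancel, and the last term of `b`, which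
  multiplies the last factor into the first one, is `-ψ̃_n(t)` (`hochschild_psi`).
* The cyclic operator maps each summand to the next one (`cyc_apply_of_eq_contour`), so the iterates
  of `ψ̃_n(t)` under `t_n^0, ..., t_n^n` sum to zero (`sum_cyc_pow_psiTilde`), and such a vector is
  in the image of `1 - t_n` (`mem_map_one_sub_of_sum_pow_eq_zero`).

It remains to see that the chains involved lie in `𝓕^(n)` for `t > 0`. They are integrals of tensors
`⊗_p e^{-s_p x²} x^{e_p}` over finite measures on the simplex `s_0 + ... + s_n = t`, a class that is
stable under the cyclic operator (`cyc_mem_heatChains`). On the part of the simplex where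
`s_k ≥ t / (n + 1)` the factor number `k` is in `𝓓_{1/m}` for large `m`, and all factors are
Lipschitz in `s` with respect to all seminorms if the orders `m_j` exceed the exponents by two,
since `∂_s` multiplies by `-x²`. Hence the Riemann sums are Cauchy sequences for the projective
seminorms (`integral_tensor_mem_completedTensor`, `heatChain_mem_F`).
-/

noncomputable section

namespace CyclicHeat

/-! ### Peeling the first coordinate off a simplex -/

/-- The measure used for the coordinate `t_p` of `t Δ_K`: Lebesgue measure for `p ∈ K`, and the
unit mass at `0` otherwise. -/
def slotMeasure (K : Finset ℕ) (p : ℕ) : Measure ℝ :=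
  if p ∈ K then volume else Measure.dirac 0

instance sigmaFinite_slotMeasure (K : Finset ℕ) (p : ℕ) : SigmaFinite (slotMeasure K p) := by
  unfold slotMeasure; split_ifs <;> infer_instance

instance isLocallyFiniteMeasure_slotMeasure (K : Finset ℕ) (p : ℕ) :
    IsLocallyFiniteMeasure (slotMeasure K p) := by
  unfold slotMeasure; split_ifs <;> infer_instance

/-- The projection of `t Δ_K` that forgets the last coordinate. -/
def solidSimplex (n : ℕ) (t : ℝ) : Set (Fin n → ℝ) := {s | (∀ p, 0 ≤ s p) ∧ ∑ p, s p ≤ t}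

theorem isCompact_solidSimplex (n : ℕ) (t : ℝ) : IsCompact (solidSimplex n t) := by
  have hc : IsClosed (solidSimplex n t) := by
    have : solidSimplex n t = (⋂ p, {s | 0 ≤ s p}) ∩ {s | ∑ p, s p ≤ t} := by
      ext s; simp [solidSimplex]
    rw [this]
    refine IsClosed.inter (isClosed_iInter fun p => ?_) ?_
    · exact isClosed_le continuous_const (by fun_prop)
    · exact isClosed_le (by fun_prop) continuous_const
  refine IsCompact.of_isClosed_subset
    (isCompact_univ_pi fun _ : Fin n => isCompact_Icc (a := (0 : ℝ)) (b := t)) hc ?_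
  intro s hs p _
  exact ⟨hs.1 p, (Finset.single_le_sum (fun i _ => hs.1 i) (Finset.mem_univ p)).trans hs.2⟩

theorem simplexIntegral_eq (n : ℕ) (K : Finset ℕ) (t : ℝ) (g : (Fin (n + 1) → ℝ) → ℂ) :
    simplexIntegral n K t g = ∫ s in solidSimplex n t, g (Fin.snoc s (t - ∑ p, s p))
      ∂(Measure.pi fun p : Fin n => slotMeasure K p) := rfl

theorem continuous_snoc_sub_sum (n : ℕ) (t : ℝ) :
    Continuous fun s : Fin n → ℝ => (Fin.snoc s (t - ∑ p, s p) : Fin (n + 1) → ℝ) := by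
  refine continuous_pi fun j => ?_
  refine Fin.lastCases ?_ (fun i => ?_) j
  · simp only [Fin.snoc_last]; fun_prop
  · simp only [Fin.snoc_castSucc]; fun_prop

theorem cons_mem_solidSimplex {n : ℕ} {t a : ℝ} {s : Fin n → ℝ} :
    (Fin.cons a s : Fin (n + 1) → ℝ) ∈ solidSimplex (n + 1) t ↔
      0 ≤ a ∧ s ∈ solidSimplex n (t - a) := by
  simp only [solidSimplex, Set.mem_ofPred_eq, Fin.forall_fin_succ, Fin.cons_zero, Fin.cons_succ,
    Fin.sum_univ_succ, and_assoc, le_sub_iff_add_le']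

/-- Fubini for the first coordinate of a simplex. -/
theorem simplexIntegral_succ {n : ℕ} {K K' : Finset ℕ} (hK : ∀ p, p + 1 ∈ K' ↔ p ∈ K) (t : ℝ)
    {g : (Fin (n + 2) → ℝ) → ℂ} (hg : Continuous g) :
    IntegrableOn (fun a => simplexIntegral n K (t - a) fun s => g (Fin.cons a s)) (Set.Icc 0 t)
      (slotMeasure K' 0) ∧
    simplexIntegral (n + 1) K' t g =
      ∫ a in Set.Icc 0 t, simplexIntegral n K (t - a) (fun s => g (Fin.cons a s))
        ∂(slotMeasure K' 0) := by
  set H : (Fin (n + 1) → ℝ) → ℂ := (solidSimplex (n + 1) t).indicator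
    fun s => g (Fin.snoc s (t - ∑ p, s p)) with hH
  have hms : ∀ m u, MeasurableSet (solidSimplex m u) := fun m u =>
    (isCompact_solidSimplex m u).measurableSet
  have hi : Integrable H (Measure.pi fun p : Fin (n + 1) => slotMeasure K' p) := by
    rw [hH, integrable_indicator_iff (hms _ _)]
    exact (hg.comp (continuous_snoc_sub_sum (n + 1) t)).continuousOn.integrableOn_compact
      (isCompact_solidSimplex _ _)
  have hmp := (measurePreserving_piFinSuccAbove (fun p : Fin (n + 1) => slotMeasure K' p) 0).symm
  have hcons : ∀ z : ℝ × (Fin n → ℝ),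
      (MeasurableEquiv.piFinSuccAbove (fun _ : Fin (n + 1) => ℝ) 0).symm z = Fin.cons z.1 z.2 := by
    intro z; simp only [MeasurableEquiv.piFinSuccAbove, Fin.insertNthEquiv_zero]; rfl
  have hpi : (Measure.pi fun j : Fin n => slotMeasure K' (Fin.succAbove 0 j : Fin (n + 1))) =
      Measure.pi fun j : Fin n => slotMeasure K j := by
    congr 1; funext j
    simp [slotMeasure, hK]
  rw [hpi] at hmp
  have hi2 := (hmp.integrable_comp_emb (MeasurableEquiv.measurableEmbedding _)).2 hi
  have hint := hmp.integral_comp (MeasurableEquiv.measurableEmbedding _) H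
  have hinner : ∀ a, ∫ s, H (Fin.cons a s) ∂(Measure.pi fun j : Fin n => slotMeasure K j) =
      (Set.Icc 0 t).indicator
        (fun a => simplexIntegral n K (t - a) fun s => g (Fin.cons a s)) a := by
    intro a
    have hsum : ∀ s : Fin n → ℝ, ∑ p, (Fin.cons a s : Fin (n + 1) → ℝ) p = a + ∑ p, s p := by
      intro s; simp [Fin.sum_univ_succ]
    by_cases ha : a ∈ Set.Icc 0 t
    · rw [Set.indicator_of_mem ha, simplexIntegral_eq, ← integral_indicator (hms _ _)]
      congr 1; funext s
      by_cases hs : s ∈ solidSimplex n (t - a)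
      · rw [hH, Set.indicator_of_mem hs,
          Set.indicator_of_mem (cons_mem_solidSimplex.2 ⟨ha.1, hs⟩), Fin.cons_snoc_eq_snoc_cons,
          hsum, sub_sub]
      · rw [hH, Set.indicator_of_notMem hs,
          Set.indicator_of_notMem (fun h => hs (cons_mem_solidSimplex.1 h).2)]
    · rw [Set.indicator_of_notMem ha]
      refine integral_eq_zero_of_ae (ae_of_all _ fun s => ?_)
      refine Set.indicator_of_notMem (fun h => ha ?_) _
      obtain ⟨h0, h1⟩ := cons_mem_solidSimplex.1 h
      exact ⟨h0, sub_nonneg.1 ((Finset.sum_nonneg fun i _ => h1.1 i).trans h1.2)⟩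
  simp only [Function.comp_def, hcons] at hi2 hint
  constructor
  · rw [← integrable_indicator_iff measurableSet_Icc]
    have := hi2.integral_prod_left
    simp only [hinner] at this
    exact this
  · rw [simplexIntegral_eq, ← integral_indicator (hms _ _), ← hint, integral_prod _ hi2,
      ← integral_indicator measurableSet_Icc]
    simp only [hinner]
    rfl

/-! ### Integrals of Gaussian tensors -/

theorem continuous_heat (i : ℕ) (x : ℝ) : Continuous fun s => heat s i x := by
  unfold heat; fun_prop

/-- The integral over `t Δ_K` of `⊗_p e^{-t_p x²} x^{e_p}`. -/
def heatIntegral (n : ℕ) (K : Finset ℕ) (e : ℕ → ℕ) (t : ℝ) : Fun n := fun x =>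
  simplexIntegral n K t fun s => tensor (fun p : Fin (n + 1) => heat (s p) (e p)) x

theorem heatIntegral_zero (K : Finset ℕ) (e : ℕ → ℕ) {t : ℝ} (ht : 0 ≤ t) (x : Fin 1 → ℝ) :
    heatIntegral 0 K e t x = heat t (e 0) (x 0) := by
  have h : solidSimplex 0 t = Set.univ := by ext s; simp [solidSimplex, ht]
  rw [heatIntegral, simplexIntegral_eq, h, Measure.restrict_univ, Measure.pi_of_empty _ default,
    integral_dirac]
  simp [tensor, Fin.snoc]

theorem tensor_heat_cons {n : ℕ} (e : ℕ → ℕ) (a : ℝ) (s : Fin (n + 1) → ℝ)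
    (x : Fin (n + 2) → ℝ) :
    tensor (fun p : Fin (n + 2) => heat ((Fin.cons a s : Fin (n + 2) → ℝ) p) (e p)) x =
      heat a (e 0) (x 0) *
        tensor (fun p : Fin (n + 1) => heat (s p) (e (p + 1))) (Fin.tail x) := by
  simp [tensor, Fin.prod_univ_succ (n := n + 1), Fin.tail]

theorem simplexIntegral_const_mul (n : ℕ) (K : Finset ℕ) (t : ℝ) (c : ℂ)
    (g : (Fin (n + 1) → ℝ) → ℂ) :
    simplexIntegral n K t (fun s => c * g s) = c * simplexIntegral n K t g := by
  simp only [simplexIntegral_eq, integral_const_mul]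

theorem continuous_tensor_heat {n : ℕ} (e : Fin n → ℕ) (x : Fin n → ℝ) :
    Continuous fun s : Fin n → ℝ => tensor (fun p => heat (s p) (e p)) x :=
  continuous_finsetProd _ fun p _ => (continuous_heat (e p) (x p)).comp (continuous_apply p)

theorem heatIntegral_succ {n : ℕ} {K K' : Finset ℕ} (hK : ∀ p, p + 1 ∈ K' ↔ p ∈ K)
    (e : ℕ → ℕ) (t : ℝ) (x : Fin (n + 2) → ℝ) :
    IntegrableOn (fun a => heat a (e 0) (x 0) *
      heatIntegral n K (fun p => e (p + 1)) (t - a) (Fin.tail x)) (Set.Icc 0 t)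
      (slotMeasure K' 0) ∧
    heatIntegral (n + 1) K' e t x = ∫ a in Set.Icc 0 t, heat a (e 0) (x 0) *
      heatIntegral n K (fun p => e (p + 1)) (t - a) (Fin.tail x) ∂(slotMeasure K' 0) := by
  have h := simplexIntegral_succ hK t
    (continuous_tensor_heat (fun p : Fin (n + 2) => e p) x)
  simp only [tensor_heat_cons, simplexIntegral_const_mul] at h
  exact h

/-- If `0` is a vertex, the coordinate `t_0` runs over `[0, t]`. -/
theorem heatIntegral_succ_of_mem {n : ℕ} {K K' : Finset ℕ} (hK : ∀ p, p + 1 ∈ K' ↔ p ∈ K)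
    (h0 : 0 ∈ K') (e : ℕ → ℕ) {t : ℝ} (ht : 0 ≤ t) (x : Fin (n + 2) → ℝ) :
    IntervalIntegrable (fun a => heat a (e 0) (x 0) *
      heatIntegral n K (fun p => e (p + 1)) (t - a) (Fin.tail x)) volume 0 t ∧
    heatIntegral (n + 1) K' e t x = ∫ a in (0 : ℝ)..t, heat a (e 0) (x 0) *
      heatIntegral n K (fun p => e (p + 1)) (t - a) (Fin.tail x) := by
  have h := heatIntegral_succ hK e t x
  have hm : slotMeasure K' 0 = volume := if_pos h0
  rw [hm] at h
  refine ⟨?_, ?_⟩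
  · rw [intervalIntegrable_iff_integrableOn_Icc_of_le ht]
    exact h.1
  · rw [h.2, intervalIntegral.integral_of_le ht, integral_Icc_eq_integral_Ioc]

/-- If `0` is not a vertex, then `t_0 = 0`. -/
theorem heatIntegral_succ_of_notMem {n : ℕ} {K K' : Finset ℕ} (hK : ∀ p, p + 1 ∈ K' ↔ p ∈ K)
    (h0 : 0 ∉ K') (e : ℕ → ℕ) {t : ℝ} (ht : 0 ≤ t) (x : Fin (n + 2) → ℝ) :
    heatIntegral (n + 1) K' e t x = heat 0 (e 0) (x 0) *
      heatIntegral n K (fun p => e (p + 1)) t (Fin.tail x) := by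
  have h := heatIntegral_succ hK e t x
  have hm : slotMeasure K' 0 = Measure.dirac 0 := if_neg h0
  rw [hm] at h
  rw [h.2, setIntegral_dirac, if_pos ⟨le_rfl, ht⟩, sub_zero]

theorem heat_zero_zero (x : ℝ) : heat 0 0 x = 1 := by simp [heat]

theorem heat_succ (s : ℝ) (i : ℕ) (x : ℝ) : heat s (i + 1) x = x * heat s i x := by
  simp [heat, pow_succ]; ring

/-- Raising the first exponent by one multiplies the integral by the first variable. -/
theorem heatIntegral_add_ite (n : ℕ) (K : Finset ℕ) (e : ℕ → ℕ) (t : ℝ)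
    (x : Fin (n + 1) → ℝ) :
    heatIntegral n K (fun p => e p + if p = 0 then 1 else 0) t x =
      x 0 * heatIntegral n K e t x := by
  unfold heatIntegral
  rw [← simplexIntegral_const_mul]
  congr 1; funext s
  simp [tensor, Fin.prod_univ_succ, heat_succ, mul_assoc]

/-! ### Recursion for the combinatorial data -/

/-- The set `{0} ∪ (K + d)`. -/
def consShift (d : ℕ) (K : Finset ℕ) : Finset ℕ := insert 0 (K.image (· + d))

/-- The set `A + d`. -/
def shift (d : ℕ) (A : Finset ℕ) : Finset ℕ := A.image (· + d)

theorem mem_shift {d : ℕ} {A : Finset ℕ} {p : ℕ} : p ∈ shift d A ↔ d ≤ p ∧ p - d ∈ A := by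
  simp only [shift, Finset.mem_image]
  constructor
  · rintro ⟨a, ha, rfl⟩; simpa using ha
  · rintro ⟨h, h'⟩; exact ⟨p - d, h', by omega⟩

theorem mem_consShift {d : ℕ} {K : Finset ℕ} {p : ℕ} :
    p ∈ consShift d K ↔ p = 0 ∨ d ≤ p ∧ p - d ∈ K := by
  rw [consShift, Finset.mem_insert, ← shift, mem_shift]

theorem zero_mem_consShift (d : ℕ) (K : Finset ℕ) : 0 ∈ consShift d K := by simp [mem_consShift]

theorem mem_L {K : Finset ℕ} {p : ℕ} : p ∈ L K ↔ p ∈ K ∧ p + 1 ∈ K := by simp [L]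

theorem mem_S {n : ℕ} {K : Finset ℕ} :
    K ∈ S n ↔ (∀ p ∈ K, p ≤ n) ∧ 0 ∈ K ∧ n ∈ K ∧ ∀ p < n, p ∈ K ∨ p + 1 ∈ K := by
  simp [S, Finset.subset_iff]

theorem mem_C {n : ℕ} {K A : Finset ℕ} : (K, A) ∈ C n ↔ K ∈ S n ∧ A ⊆ L K := by
  simp only [C, Finset.mem_filter, Finset.mem_product, Finset.mem_powerset]
  constructor
  · rintro ⟨⟨h, _⟩, h'⟩; exact ⟨h, h'⟩
  · rintro ⟨h, h'⟩
    refine ⟨⟨h, fun p hp => ?_⟩, h'⟩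
    have := (mem_S.1 h).1 _ (mem_L.1 (h' hp)).2
    simp; omega

theorem consShift_mem_S {n d : ℕ} (hd : d = 1 ∨ d = 2) {K : Finset ℕ} (hK : K ∈ S n) :
    consShift d K ∈ S (n + d) := by
  rw [mem_S] at hK ⊢
  obtain ⟨h1, h2, h3, h4⟩ := hK
  refine ⟨fun p hp => ?_, zero_mem_consShift _ _, mem_consShift.2 (Or.inr ⟨by omega, by simpa⟩),
    fun p hp => ?_⟩
  · rcases mem_consShift.1 hp with h | ⟨h, h'⟩
    · omega
    · have := h1 _ h'; omega
  · simp only [mem_consShift]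
    by_cases hp' : d ≤ p
    · rcases h4 (p - d) (by omega) with h | h
      · exact Or.inl (Or.inr ⟨hp', h⟩)
      · exact Or.inr (Or.inr ⟨by omega, by rwa [Nat.sub_add_comm hp']⟩)
    · rcases Nat.eq_zero_or_pos p with h | h
      · exact Or.inl (Or.inl h)
      · have e : p + 1 = d := by omega
        exact Or.inr (Or.inr ⟨by omega, by rw [e, Nat.sub_self]; exact h2⟩)

/-- The preimage of `K` under the translation by `d`. -/
def unshift (d : ℕ) (K : Finset ℕ) : Finset ℕ := (K.filter (d ≤ ·)).image (· - d)

theorem mem_unshift {d : ℕ} {K : Finset ℕ} {p : ℕ} : p ∈ unshift d K ↔ p + d ∈ K := by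
  simp only [unshift, Finset.mem_image, Finset.mem_filter]
  constructor
  · rintro ⟨a, ⟨h, h'⟩, rfl⟩; rwa [Nat.sub_add_cancel h']
  · intro h; exact ⟨p + d, ⟨h, by omega⟩, by omega⟩

theorem unshift_mem_S {n d : ℕ} {K : Finset ℕ} (hK : K ∈ S (n + d)) (h : d ∈ K) :
    unshift d K ∈ S n := by
  rw [mem_S] at hK ⊢
  obtain ⟨h1, h2, h3, h4⟩ := hK
  refine ⟨fun p hp => ?_, mem_unshift.2 (by simpa), mem_unshift.2 h3, fun p hp => ?_⟩
  · have := h1 _ (mem_unshift.1 hp); omega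
  · simp only [mem_unshift]
    rcases h4 (p + d) (by omega) with h | h
    · exact Or.inl h
    · exact Or.inr (by rwa [add_right_comm])

theorem unshift_consShift {d : ℕ} (hd : 0 < d) (K : Finset ℕ) : unshift d (consShift d K) = K := by
  ext p; simp [mem_unshift, mem_consShift]; omega

theorem consShift_unshift_one {K : Finset ℕ} (h0 : 0 ∈ K) : consShift 1 (unshift 1 K) = K := by
  ext p
  rcases p with _ | p <;> simp [mem_unshift, mem_consShift, h0]

theorem consShift_unshift_two {K : Finset ℕ} (h0 : 0 ∈ K) (h1 : 1 ∉ K) :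
    consShift 2 (unshift 2 K) = K := by
  ext p
  rcases p with _ | _ | p <;> simp [mem_unshift, mem_consShift, h0, h1]

theorem unshift_shift (d : ℕ) (A : Finset ℕ) : unshift d (shift d A) = A := by
  ext p; simp [mem_unshift, mem_shift]

theorem L_consShift_one {K : Finset ℕ} (h0 : 0 ∈ K) : L (consShift 1 K) = consShift 1 (L K) := by
  ext p
  rcases p with _ | p <;> simp [mem_L, mem_consShift, h0]

theorem L_consShift_two (K : Finset ℕ) : L (consShift 2 K) = shift 2 (L K) := by
  ext p
  rcases p with _ | _ | p <;> simp [mem_L, mem_consShift, mem_shift]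

theorem nu_consShift_one (n : ℕ) (K : Finset ℕ) (h0 : 0 ∈ K) :
    nu (n + 1) (consShift 1 K) = nu n K + (n + 2) := by
  have e : ((consShift 1 K).erase 0).image (· - 1) = K := by
    rw [consShift, Finset.erase_insert (by simp), Finset.image_image]
    ext p; simp
  have h1 : 1 ∈ consShift 1 K := by simp [mem_consShift, h0]
  rcases n with _ | n
  · simp [nu]
  · rw [nu, if_pos h1, e]

theorem nu_consShift_two (n : ℕ) (K : Finset ℕ) : nu (n + 2) (consShift 2 K) = nu n K + 1 := by
  have e : ((consShift 2 K).erase 0).image (· - 2) = K := by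
    rw [consShift, Finset.erase_insert (by simp), Finset.image_image]
    ext p; simp
  have h1 : 1 ∉ consShift 2 K := by simp [mem_consShift]
  rw [nu, if_neg h1, e]

theorem card_shift (d : ℕ) (A : Finset ℕ) : (shift d A).card = A.card :=
  Finset.card_image_of_injective _ (add_left_injective d)

theorem deg_of_subset (n : ℕ) {K A : Finset ℕ} (h : A ⊆ L K) : deg n K A = A.card + nu n K := by
  rw [deg, Finset.inter_eq_right.2 h]

theorem shift_subset_L_one {K A : Finset ℕ} (h0 : 0 ∈ K) (h : A ⊆ L K) :
    shift 1 A ⊆ L (consShift 1 K) := by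
  rw [L_consShift_one h0]
  exact (Finset.image_subset_image h).trans (Finset.subset_insert _ _)

theorem consShift_subset_L_one {K A : Finset ℕ} (h0 : 0 ∈ K) (h : A ⊆ L K) :
    consShift 1 A ⊆ L (consShift 1 K) := by
  rw [L_consShift_one h0]
  exact Finset.insert_subset_insert _ (Finset.image_subset_image h)

theorem shift_subset_L_two {K A : Finset ℕ} (h : A ⊆ L K) :
    shift 2 A ⊆ L (consShift 2 K) := by
  rw [L_consShift_two]
  exact Finset.image_subset_image h

theorem expo_shift_one (K A : Finset ℕ) (p : ℕ) :
    expo (consShift 1 K) (shift 1 A) (p + 1) = expo K A p := by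
  rcases p with _ | p <;> simp [expo, mem_consShift, mem_shift]

theorem expo_shift_one_zero (K A : Finset ℕ) (h0 : 0 ∈ K) :
    expo (consShift 1 K) (shift 1 A) 0 = 1 := by
  simp [expo, mem_consShift, mem_shift, h0]

theorem expo_consShift_one (K A : Finset ℕ) (h0 : 0 ∈ K) (p : ℕ) :
    expo (consShift 1 K) (consShift 1 A) (p + 1) = expo K A p + if p = 0 then 1 else 0 := by
  rcases p with _ | p
  · simp [expo, mem_consShift, h0, add_comm]
  · simp [expo, mem_consShift]

theorem expo_consShift_one_zero (K A : Finset ℕ) :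
    expo (consShift 1 K) (consShift 1 A) 0 = 0 := by
  simp [expo, mem_consShift]

theorem expo_shift_two (K A : Finset ℕ) (p : ℕ) :
    expo (consShift 2 K) (shift 2 A) (p + 2) = expo K A p := by
  rcases p with _ | p <;> simp [expo, mem_consShift, mem_shift]

theorem expo_shift_two_zero (K A : Finset ℕ) : expo (consShift 2 K) (shift 2 A) 0 = 0 := by
  simp [expo, mem_consShift, mem_shift]

theorem expo_shift_two_one (K A : Finset ℕ) : expo (consShift 2 K) (shift 2 A) 1 = 0 := by
  simp [expo, mem_consShift, mem_shift]

/-- The classes with `1 ∈ K` and `σ_0 = 0` correspond to `C_n`. -/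
theorem sum_C_filter_notMem {M : Type*} [AddCommMonoid M] (n : ℕ)
    (f : Finset ℕ × Finset ℕ → M) :
    ∑ c ∈ C (n + 1) with 1 ∈ c.1 ∧ 0 ∉ c.2, f c =
      ∑ c ∈ C n, f (consShift 1 c.1, shift 1 c.2) := by
  symm
  refine Finset.sum_nbij' (fun c => (consShift 1 c.1, shift 1 c.2))
    (fun c => (unshift 1 c.1, unshift 1 c.2)) ?_ ?_ ?_ ?_ fun _ _ => rfl
  · rintro ⟨K, A⟩ h
    rw [mem_C] at h
    have h0 := (mem_S.1 h.1).2.1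
    rw [Finset.mem_filter, mem_C]
    exact ⟨⟨consShift_mem_S (Or.inl rfl) h.1, shift_subset_L_one h0 h.2⟩,
      by simp [mem_consShift, h0], by simp [mem_shift]⟩
  · rintro ⟨K, A⟩ h
    rw [Finset.mem_filter, mem_C] at h
    obtain ⟨⟨h1, h2⟩, h3, h4⟩ := h
    refine mem_C.2 ⟨unshift_mem_S h1 h3, fun p hp => ?_⟩
    have := mem_L.1 (h2 (mem_unshift.1 hp))
    exact mem_L.2 ⟨mem_unshift.2 this.1, mem_unshift.2 this.2⟩
  · rintro ⟨K, A⟩ -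
    simp only [unshift_consShift one_pos, unshift_shift]
  · rintro ⟨K, A⟩ h
    rw [Finset.mem_filter, mem_C] at h
    obtain ⟨⟨h1, h2⟩, h3, h4⟩ := h
    have e : shift 1 (unshift 1 A) = A := by
      ext p
      rcases p with _ | p
      · simpa [mem_shift] using h4
      · simp [mem_shift, mem_unshift]
    simp only [consShift_unshift_one (mem_S.1 h1).2.1, e]

/-- The classes with `1 ∈ K` and `σ_0 = 1` correspond to `C_n`. -/
theorem sum_C_filter_mem {M : Type*} [AddCommMonoid M] (n : ℕ)
    (f : Finset ℕ × Finset ℕ → M) :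
    ∑ c ∈ C (n + 1) with 1 ∈ c.1 ∧ 0 ∈ c.2, f c =
      ∑ c ∈ C n, f (consShift 1 c.1, consShift 1 c.2) := by
  symm
  refine Finset.sum_nbij' (fun c => (consShift 1 c.1, consShift 1 c.2))
    (fun c => (unshift 1 c.1, unshift 1 c.2)) ?_ ?_ ?_ ?_ fun _ _ => rfl
  · rintro ⟨K, A⟩ h
    rw [mem_C] at h
    have h0 := (mem_S.1 h.1).2.1
    rw [Finset.mem_filter, mem_C]
    exact ⟨⟨consShift_mem_S (Or.inl rfl) h.1, consShift_subset_L_one h0 h.2⟩,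
      by simp [mem_consShift, h0], by simp [mem_consShift]⟩
  · rintro ⟨K, A⟩ h
    rw [Finset.mem_filter, mem_C] at h
    obtain ⟨⟨h1, h2⟩, h3, h4⟩ := h
    refine mem_C.2 ⟨unshift_mem_S h1 h3, fun p hp => ?_⟩
    have := mem_L.1 (h2 (mem_unshift.1 hp))
    exact mem_L.2 ⟨mem_unshift.2 this.1, mem_unshift.2 this.2⟩
  · rintro ⟨K, A⟩ -
    simp only [unshift_consShift one_pos]
  · rintro ⟨K, A⟩ h
    rw [Finset.mem_filter, mem_C] at h
    simp only [consShift_unshift_one (mem_S.1 h.1.1).2.1, consShift_unshift_one h.2.2]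

/-- The classes with `1 ∉ K` correspond to `C_n` by a shift by two: then `2 ∈ K`, and neither `0`
nor `1` is in `L(K)`. -/
theorem sum_C_filter_one_notMem {M : Type*} [AddCommMonoid M] (n : ℕ)
    (f : Finset ℕ × Finset ℕ → M) :
    ∑ c ∈ C (n + 2) with 1 ∉ c.1, f c = ∑ c ∈ C n, f (consShift 2 c.1, shift 2 c.2) := by
  symm
  refine Finset.sum_nbij' (fun c => (consShift 2 c.1, shift 2 c.2))
    (fun c => (unshift 2 c.1, unshift 2 c.2)) ?_ ?_ ?_ ?_ fun _ _ => rfl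
  · rintro ⟨K, A⟩ h
    rw [mem_C] at h
    rw [Finset.mem_filter, mem_C]
    exact ⟨⟨consShift_mem_S (Or.inr rfl) h.1, shift_subset_L_two h.2⟩, by simp [mem_consShift]⟩
  · rintro ⟨K, A⟩ h
    rw [Finset.mem_filter, mem_C] at h
    obtain ⟨⟨h1, h2⟩, h3⟩ := h
    have h4 := ((mem_S.1 h1).2.2.2 1 (by omega)).resolve_left h3
    refine mem_C.2 ⟨unshift_mem_S h1 h4, fun p hp => ?_⟩
    have := mem_L.1 (h2 (mem_unshift.1 hp))
    exact mem_L.2 ⟨mem_unshift.2 this.1, mem_unshift.2 this.2⟩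
  · rintro ⟨K, A⟩ -
    simp only [unshift_consShift two_pos, unshift_shift]
  · rintro ⟨K, A⟩ h
    rw [Finset.mem_filter, mem_C] at h
    obtain ⟨⟨h1, h2⟩, h3⟩ := h
    have e : shift 2 (unshift 2 A) = A := by
      ext p
      rcases p with _ | _ | p
      · simpa [mem_shift] using fun h => h3 (mem_L.1 (h2 h)).2
      · simpa [mem_shift] using fun h => h3 (mem_L.1 (h2 h)).1
      · simp [mem_shift, mem_unshift]
    simp only [consShift_unshift_two (mem_S.1 h1).2.1 h3, e]

theorem sum_C_eq {M : Type*} [AddCommMonoid M] (n : ℕ) (f : Finset ℕ × Finset ℕ → M) :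
    ∑ c ∈ C (n + 1), f c = (∑ c ∈ C n, f (consShift 1 c.1, shift 1 c.2) +
      ∑ c ∈ C n, f (consShift 1 c.1, consShift 1 c.2)) + ∑ c ∈ C (n + 1) with 1 ∉ c.1, f c := by
  rw [← sum_C_filter_notMem, ← sum_C_filter_mem, ← Finset.sum_filter_add_sum_filter_not _
    (fun c => 1 ∈ c.1), ← Finset.sum_filter_add_sum_filter_not _ (fun c => 0 ∉ c.2)]
  simp only [Finset.filter_filter, not_not]

theorem sum_C_one_filter {M : Type*} [AddCommMonoid M] (f : Finset ℕ × Finset ℕ → M) :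
    ∑ c ∈ C 1 with 1 ∉ c.1, f c = 0 := by
  refine Finset.sum_eq_zero ?_
  rintro ⟨K, A⟩ h
  rw [Finset.mem_filter, mem_C] at h
  exact absurd (mem_S.1 h.1.1).2.2.1 h.2

theorem sum_C_zero {M : Type*} [AddCommMonoid M] (f : Finset ℕ × Finset ℕ → M) :
    ∑ c ∈ C 0, f c = f ({0}, ∅) := by
  have : C 0 = {({0}, ∅)} := by decide
  rw [this, Finset.sum_singleton]

/-! ### Recursion for the chains -/

theorem chi_eq (n : ℕ) (K A : Finset ℕ) (t : ℝ) (x : Fin (n + 1) → ℝ) :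
    chi n K A t x = (-1) ^ deg n K A * heatIntegral n K (expo K A) t x := rfl

/-- The case `1 ∈ K`, `σ_0 = 0`: the variable `x_0` appears as a factor. -/
theorem chi_consShift_shift_one {n : ℕ} {K A : Finset ℕ} (hC : (K, A) ∈ C n) {t : ℝ}
    (ht : 0 ≤ t) (x : Fin (n + 2) → ℝ) :
    IntervalIntegrable (fun a => heat a 0 (x 0) *
      ((-1) ^ n * x 0 * chi n K A (t - a) (Fin.tail x))) volume 0 t ∧
    chi (n + 1) (consShift 1 K) (shift 1 A) t x = ∫ a in (0 : ℝ)..t, heat a 0 (x 0) *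
      ((-1) ^ n * x 0 * chi n K A (t - a) (Fin.tail x)) := by
  rw [mem_C] at hC
  have h0 := (mem_S.1 hC.1).2.1
  have h := heatIntegral_succ_of_mem (K := K) (K' := consShift 1 K) (by simp [mem_consShift])
    (zero_mem_consShift _ _) (expo (consShift 1 K) (shift 1 A)) ht x
  simp only [expo_shift_one, expo_shift_one_zero K A h0] at h
  have e : ∀ a, heat a 0 (x 0) * ((-1) ^ n * x 0 * chi n K A (t - a) (Fin.tail x)) =
      ((-1) ^ n * (-1) ^ deg n K A) * (heat a 1 (x 0) *
        heatIntegral n K (fun p => expo K A p) (t - a) (Fin.tail x)) := by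
    intro a
    rw [chi_eq, heat_succ]; ring
  simp only [e]
  refine ⟨h.1.const_mul _, ?_⟩
  rw [intervalIntegral.integral_const_mul, ← h.2, chi_eq,
    deg_of_subset _ (shift_subset_L_one h0 hC.2), deg_of_subset _ hC.2, card_shift,
    nu_consShift_one n K h0]
  ring

/-- The case `1 ∈ K`, `σ_0 = 1`: the variable `x_1` appears as a factor, with the
opposite sign. -/
theorem chi_consShift_consShift_one {n : ℕ} {K A : Finset ℕ} (hC : (K, A) ∈ C n) {t : ℝ}
    (ht : 0 ≤ t) (x : Fin (n + 2) → ℝ) :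
    IntervalIntegrable (fun a => heat a 0 (x 0) *
      (-((-1) ^ n * x 1 * chi n K A (t - a) (Fin.tail x)))) volume 0 t ∧
    chi (n + 1) (consShift 1 K) (consShift 1 A) t x = ∫ a in (0 : ℝ)..t, heat a 0 (x 0) *
      (-((-1) ^ n * x 1 * chi n K A (t - a) (Fin.tail x))) := by
  rw [mem_C] at hC
  have h0 := (mem_S.1 hC.1).2.1
  have h := heatIntegral_succ_of_mem (K := K) (K' := consShift 1 K) (by simp [mem_consShift])
    (zero_mem_consShift _ _) (expo (consShift 1 K) (consShift 1 A)) ht x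
  simp only [expo_consShift_one K A h0, expo_consShift_one_zero, heatIntegral_add_ite] at h
  have e : ∀ a, heat a 0 (x 0) * (-((-1) ^ n * x 1 * chi n K A (t - a) (Fin.tail x))) =
      (-((-1) ^ n * (-1) ^ deg n K A)) * (heat a 0 (x 0) * (Fin.tail x 0 *
        heatIntegral n K (fun p => expo K A p) (t - a) (Fin.tail x))) := by
    intro a
    have e1 : Fin.tail x 0 = x 1 := rfl
    rw [chi_eq, e1]; ring
  simp only [e]
  refine ⟨h.1.const_mul _, ?_⟩
  have h00 : 0 ∉ shift 1 A := by simp [mem_shift]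
  have hcard : (consShift 1 A).card = A.card + 1 := by
    rw [consShift, ← shift, Finset.card_insert_of_notMem h00, card_shift]
  rw [intervalIntegral.integral_const_mul, ← h.2, chi_eq,
    deg_of_subset _ (consShift_subset_L_one h0 hC.2), deg_of_subset _ hC.2, hcard,
    nu_consShift_one n K h0]
  ring

/-- The case `1 ∉ K`: the variable `x_1` does not appear. -/
theorem chi_consShift_two {n : ℕ} {K A : Finset ℕ} (hC : (K, A) ∈ C n) {t : ℝ}
    (ht : 0 ≤ t) (x : Fin (n + 3) → ℝ) :
    IntervalIntegrable (fun a => heat a 0 (x 0) *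
      (-chi n K A (t - a) (Fin.tail (Fin.tail x)))) volume 0 t ∧
    chi (n + 2) (consShift 2 K) (shift 2 A) t x = ∫ a in (0 : ℝ)..t, heat a 0 (x 0) *
      (-chi n K A (t - a) (Fin.tail (Fin.tail x))) := by
  rw [mem_C] at hC
  have h := heatIntegral_succ_of_mem (K := shift 1 K) (K' := consShift 2 K)
    (by simp [mem_consShift, mem_shift])
    (zero_mem_consShift _ _) (expo (consShift 2 K) (shift 2 A)) ht x
  simp only [expo_shift_two_zero] at h
  have e : ∀ a ∈ Set.uIcc 0 t,
      heat a 0 (x 0) * (-chi n K A (t - a) (Fin.tail (Fin.tail x))) =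
      -(-1) ^ deg n K A * (heat a 0 (x 0) * heatIntegral (n + 1) (shift 1 K)
        (fun p => expo (consShift 2 K) (shift 2 A) (p + 1)) (t - a) (Fin.tail x)) := by
    intro a ha
    rw [Set.uIcc_of_le ht] at ha
    rw [heatIntegral_succ_of_notMem (K := K) (by simp [mem_shift]) (by simp [mem_shift]) _
      (sub_nonneg.2 ha.2)]
    simp only [expo_shift_two, zero_add, expo_shift_two_one, heat_zero_zero, chi_eq]
    ring
  refine ⟨(intervalIntegrable_congr fun a ha => (e a (Set.uIoc_subset_uIcc ha))).2
    (h.1.const_mul _), ?_⟩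
  rw [intervalIntegral.integral_congr e, intervalIntegral.integral_const_mul, ← h.2, chi_eq,
    deg_of_subset _ (shift_subset_L_two hC.2), deg_of_subset _ hC.2, card_shift,
    nu_consShift_two]
  ring

theorem psi_apply (n : ℕ) (t : ℝ) (x : Fin (n + 1) → ℝ) :
    psi n t x = ∑ c ∈ C n, chi n c.1 c.2 t x := by
  rw [psi, Finset.sum_apply]

theorem psi_zero_apply {t : ℝ} (ht : 0 ≤ t) (x : Fin 1 → ℝ) : psi 0 t x = heat t 0 (x 0) := by
  rw [psi_apply, sum_C_zero, chi_eq, heatIntegral_zero _ _ ht]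
  simp [deg, nu, L, expo]

theorem intervalIntegrable_and_sum_filter_one_mem (n : ℕ) {t : ℝ} (ht : 0 ≤ t)
    (x : Fin (n + 2) → ℝ) :
    IntervalIntegrable (fun a => heat a 0 (x 0) *
      ((-1) ^ n * (x 0 - x 1) * psi n (t - a) (Fin.tail x))) volume 0 t ∧
    ∑ c ∈ C n, chi (n + 1) (consShift 1 c.1) (shift 1 c.2) t x +
      ∑ c ∈ C n, chi (n + 1) (consShift 1 c.1) (consShift 1 c.2) t x =
    ∫ a in (0 : ℝ)..t, heat a 0 (x 0) *
      ((-1) ^ n * (x 0 - x 1) * psi n (t - a) (Fin.tail x)) := by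
  have e : ∀ a, heat a 0 (x 0) * ((-1) ^ n * (x 0 - x 1) * psi n (t - a) (Fin.tail x)) =
      ∑ c ∈ C n, (heat a 0 (x 0) * ((-1) ^ n * x 0 * chi n c.1 c.2 (t - a) (Fin.tail x)) +
        heat a 0 (x 0) * (-((-1) ^ n * x 1 * chi n c.1 c.2 (t - a) (Fin.tail x)))) := by
    intro a
    rw [psi_apply, Finset.mul_sum, Finset.mul_sum]
    exact Finset.sum_congr rfl fun c _ => by ring
  have hi : ∀ c ∈ C n, IntervalIntegrable (fun a =>
      heat a 0 (x 0) * ((-1) ^ n * x 0 * chi n c.1 c.2 (t - a) (Fin.tail x)) +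
      heat a 0 (x 0) * (-((-1) ^ n * x 1 * chi n c.1 c.2 (t - a) (Fin.tail x)))) volume 0 t :=
    fun c hc => (chi_consShift_shift_one hc ht x).1.add (chi_consShift_consShift_one hc ht x).1
  simp only [e]
  refine ⟨?_, ?_⟩
  · have := IntervalIntegrable.sum (C n) hi
    simpa only [Finset.sum_fn] using this
  rw [intervalIntegral.integral_finsetSum hi, ← Finset.sum_add_distrib]
  refine Finset.sum_congr rfl fun c hc => ?_
  rw [intervalIntegral.integral_add (chi_consShift_shift_one hc ht x).1
    (chi_consShift_consShift_one hc ht x).1, (chi_consShift_shift_one hc ht x).2,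
    (chi_consShift_consShift_one hc ht x).2]

theorem psi_one_apply {t : ℝ} (ht : 0 ≤ t) (x : Fin 2 → ℝ) :
    psi 1 t x = ∫ a in (0 : ℝ)..t, heat a 0 (x 0) *
      ((x 0 - x 1) * psi 0 (t - a) (Fin.tail x)) := by
  rw [psi_apply, sum_C_eq, sum_C_one_filter, add_zero,
    (intervalIntegrable_and_sum_filter_one_mem 0 ht x).2]
  simp only [pow_zero, one_mul]

theorem psi_succ_succ_apply (n : ℕ) {t : ℝ} (ht : 0 ≤ t) (x : Fin (n + 3) → ℝ) :
    psi (n + 2) t x = ∫ a in (0 : ℝ)..t, heat a 0 (x 0) *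
      ((-1) ^ (n + 1) * (x 0 - x 1) * psi (n + 1) (t - a) (Fin.tail x) -
        psi n (t - a) (Fin.tail (Fin.tail x))) := by
  have h1 := intervalIntegrable_and_sum_filter_one_mem (n + 1) ht x
  have e : ∀ a, heat a 0 (x 0) * (-psi n (t - a) (Fin.tail (Fin.tail x))) =
      ∑ c ∈ C n, heat a 0 (x 0) * (-chi n c.1 c.2 (t - a) (Fin.tail (Fin.tail x))) := by
    intro a
    rw [psi_apply, ← Finset.sum_neg_distrib, Finset.mul_sum]
  have hi : ∀ c ∈ C n, IntervalIntegrable (fun a =>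
      heat a 0 (x 0) * (-chi n c.1 c.2 (t - a) (Fin.tail (Fin.tail x)))) volume 0 t :=
    fun c hc => (chi_consShift_two hc ht x).1
  have h2 : IntervalIntegrable (fun a => heat a 0 (x 0) *
      (-psi n (t - a) (Fin.tail (Fin.tail x)))) volume 0 t := by
    simp only [e]
    have := IntervalIntegrable.sum (C n) hi
    simpa only [Finset.sum_fn] using this
  simp only [sub_eq_add_neg _ (psi n _ _), mul_add (heat _ _ _)]
  rw [intervalIntegral.integral_add h1.1 h2, ← h1.2, psi_apply, sum_C_eq,
    sum_C_filter_one_notMem]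
  simp only [e]
  rw [intervalIntegral.integral_finsetSum hi]
  congr 1
  exact Finset.sum_congr rfl fun c hc => (chi_consShift_two hc ht x).2

theorem chiTilde_eq (n : ℕ) (K A : Finset ℕ) (t : ℝ) (x : Fin (n + 2) → ℝ) :
    chiTilde n K A t x = (-1) ^ deg n K A * heatIntegral (n + 1) (consShift 1 K)
      (fun p => if p = 0 then 0 else expo K A (p - 1)) t x := by
  rw [chiTilde, heatIntegral, consShift]
  congr 2
  funext s
  congr 1
  funext p
  refine Fin.cases ?_ (fun q => ?_) p
  · simp
  · simp

theorem psiTilde_succ_apply (n : ℕ) {t : ℝ} (ht : 0 ≤ t) (x : Fin (n + 2) → ℝ) :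
    psiTilde (n + 1) t x =
      ∫ a in (0 : ℝ)..t, heat a 0 (x 0) * psi n (t - a) (Fin.tail x) := by
  have key : ∀ K A : Finset ℕ,
      IntervalIntegrable (fun a => heat a 0 (x 0) * chi n K A (t - a) (Fin.tail x)) volume 0 t ∧
      chiTilde n K A t x =
        ∫ a in (0 : ℝ)..t, heat a 0 (x 0) * chi n K A (t - a) (Fin.tail x) := by
    intro K A
    have h := heatIntegral_succ_of_mem (K := K) (K' := consShift 1 K) (by simp [mem_consShift])
      (zero_mem_consShift _ _) (fun p => if p = 0 then 0 else expo K A (p - 1)) ht x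
    simp only [Nat.add_sub_cancel, Nat.add_eq_zero_iff, one_ne_zero, and_false, if_false,
      if_true] at h
    have e : ∀ a, heat a 0 (x 0) * chi n K A (t - a) (Fin.tail x) = (-1) ^ deg n K A *
        (heat a 0 (x 0) * heatIntegral n K (fun p => expo K A p) (t - a) (Fin.tail x)) := by
      intro a; rw [chi_eq]; ring
    simp only [e]
    refine ⟨h.1.const_mul _, ?_⟩
    rw [intervalIntegral.integral_const_mul, ← h.2, chiTilde_eq]
  have e : ∀ a, heat a 0 (x 0) * psi n (t - a) (Fin.tail x) =
      ∑ c ∈ C n, heat a 0 (x 0) * chi n c.1 c.2 (t - a) (Fin.tail x) := by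
    intro a
    rw [psi_apply, Finset.mul_sum]
  simp only [e]
  rw [intervalIntegral.integral_finsetSum fun c _ => (key c.1 c.2).1, psiTilde, Finset.sum_apply]
  exact Finset.sum_congr rfl fun c _ => (key c.1 c.2).2

/-! ### A contour functional -/

/-- The functional `F ↦ -(2πi)⁻¹ ∮_{|z| = r} e^{-t z²} F(z) dz`. -/
def contour (r t : ℝ) (F : ℂ → ℂ) : ℂ :=
  -(2 * Real.pi * Complex.I)⁻¹ * ∮ z in C(0, r), Complex.exp (-t * z ^ 2) * F z

theorem contour_congr {r : ℝ} (hr : 0 ≤ r) (t : ℝ) {F G : ℂ → ℂ}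
    (h : ∀ z : ℂ, ‖z‖ = r → F z = G z) : contour r t F = contour r t G := by
  unfold contour
  rw [circleIntegral.integral_congr hr]
  intro z hz
  simp only [h z (by simpa using hz)]

theorem contour_const_mul (r t : ℝ) (c : ℂ) (F : ℂ → ℂ) :
    contour r t (fun z => c * F z) = c * contour r t F := by
  unfold contour
  simp only [mul_left_comm _ c]
  rw [circleIntegral.integral_const_mul]
  ring

theorem circleIntegrable_exp_mul {r : ℝ} (hr : 0 ≤ r) (t : ℝ) {F : ℂ → ℂ}
    (hF : ContinuousOn F (Metric.sphere 0 r)) :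
    CircleIntegrable (fun z => Complex.exp (-t * z ^ 2) * F z) 0 r :=
  ContinuousOn.circleIntegrable hr (ContinuousOn.mul (by fun_prop) hF)

theorem contour_sub {r : ℝ} (hr : 0 ≤ r) (t : ℝ) {F G : ℂ → ℂ}
    (hF : ContinuousOn F (Metric.sphere 0 r)) (hG : ContinuousOn G (Metric.sphere 0 r)) :
    contour r t (fun z => F z - G z) = contour r t F - contour r t G := by
  unfold contour
  simp only [mul_sub]
  rw [circleIntegral.integral_sub (circleIntegrable_exp_mul hr t hF)
    (circleIntegrable_exp_mul hr t hG), mul_sub]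

theorem contour_sum {ι : Type*} {r : ℝ} (hr : 0 ≤ r) (t : ℝ) (s : Finset ι) {F : ι → ℂ → ℂ}
    (hF : ∀ i ∈ s, ContinuousOn (F i) (Metric.sphere 0 r)) :
    contour r t (fun z => ∑ i ∈ s, F i z) = ∑ i ∈ s, contour r t (F i) := by
  unfold contour
  simp only [Finset.mul_sum]
  rw [circleIntegral.integral_fun_sum fun i hi => circleIntegrable_exp_mul hr t (hF i hi),
    Finset.mul_sum]

theorem circleIntegral_comp_neg (r : ℝ) (G : ℂ → ℂ) :
    (∮ z in C(0, r), G (-z)) = -∮ z in C(0, r), G z := by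
  have hneg : ∀ θ, -circleMap 0 r θ = circleMap 0 r (θ + Real.pi) := by
    intro θ; simp [circleMap, add_mul, Complex.exp_add]
  have hper : Function.Periodic (fun θ => (circleMap 0 r θ * Complex.I) • G (circleMap 0 r θ))
      (2 * Real.pi) := fun θ => by simp only [periodic_circleMap 0 r θ]
  simp only [circleIntegral, deriv_circleMap]
  calc ∫ θ in (0 : ℝ)..2 * Real.pi, (circleMap 0 r θ * Complex.I) • G (-circleMap 0 r θ)
      = -∫ θ in (0 : ℝ)..2 * Real.pi, (circleMap 0 r (θ + Real.pi) * Complex.I) •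
          G (circleMap 0 r (θ + Real.pi)) := by
        rw [← intervalIntegral.integral_neg]
        congr 1; funext θ
        rw [← hneg]; simp
    _ = -∫ θ in (0 : ℝ)..2 * Real.pi, (circleMap 0 r θ * Complex.I) • G (circleMap 0 r θ) := by
        rw [intervalIntegral.integral_comp_add_right
          (fun θ => (circleMap 0 r θ * Complex.I) • G (circleMap 0 r θ))]
        have := hper.intervalIntegral_add_eq Real.pi 0
        simp only [zero_add] at this ⊢
        rw [add_comm (2 * Real.pi), this]

theorem contour_comp_neg (r t : ℝ) (F : ℂ → ℂ) :
    contour r t (fun z => F (-z)) = -contour r t F := by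
  unfold contour
  have := circleIntegral_comp_neg r fun z => Complex.exp (-t * z ^ 2) * F z
  simp only [neg_sq] at this
  rw [this, mul_neg]

theorem contour_eq_zero_of_even {r : ℝ} (hr : 0 ≤ r) (t : ℝ) {F : ℂ → ℂ}
    (h : ∀ z : ℂ, ‖z‖ = r → F (-z) = F z) : contour r t F = 0 := by
  have h1 := contour_comp_neg r t F
  rw [contour_congr hr t h] at h1
  exact self_eq_neg.1 h1

/-! ### Products of simple poles -/

/-- The function `∏_i 1 / (f_i - z)`. -/
def poles {m : ℕ} (f : Fin m → ℝ) (z : ℂ) : ℂ := ∏ i, ((f i : ℂ) - z)⁻¹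

theorem ofReal_sub_ne_zero {r a : ℝ} (ha : |a| < r) {z : ℂ} (hz : r ≤ ‖z‖) : (a : ℂ) - z ≠ 0 := by
  intro h
  rw [← sub_eq_zero.1 h, Complex.norm_real, Real.norm_eq_abs] at hz
  exact absurd ha hz.not_gt

theorem ofReal_add_ne_zero {r a : ℝ} (ha : |a| < r) {z : ℂ} (hz : r ≤ ‖z‖) : (a : ℂ) + z ≠ 0 := by
  have := ofReal_sub_ne_zero ha (z := -z) (by simpa using hz)
  simpa using this

theorem differentiableAt_poles {m : ℕ} {f : Fin m → ℝ} {r : ℝ} (hf : ∀ i, |f i| < r) {z : ℂ}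
    (hz : r ≤ ‖z‖) : DifferentiableAt ℂ (poles f) z := by
  unfold poles
  refine DifferentiableAt.fun_finsetProd fun i _ => ?_
  exact ((differentiableAt_const _).sub differentiableAt_id).inv (ofReal_sub_ne_zero (hf i) hz)

theorem continuousOn_poles {m : ℕ} {f : Fin m → ℝ} {r : ℝ} (hf : ∀ i, |f i| < r) :
    ContinuousOn (poles f) (Metric.sphere 0 r) := fun z hz =>
  (differentiableAt_poles hf (by simpa using hz.ge)).continuousAt.continuousWithinAt

theorem poles_cons {m : ℕ} (a : ℝ) (f : Fin m → ℝ) (z : ℂ) :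
    poles (Fin.cons a f : Fin (m + 1) → ℝ) z = ((a : ℂ) - z)⁻¹ * poles f z := by
  simp only [poles, Fin.prod_univ_succ, Fin.cons_zero, Fin.cons_succ]

theorem poles_tail {m : ℕ} (f : Fin (m + 1) → ℝ) (z : ℂ) :
    poles f z = ((f 0 : ℂ) - z)⁻¹ * poles (Fin.tail f) z := by
  simp only [poles, Fin.prod_univ_succ, Fin.tail]

theorem poles_neg {m : ℕ} (f : Fin m → ℝ) (z : ℂ) :
    poles (-f) z = (-1) ^ m * poles f (-z) := by
  unfold poles
  rw [← Fin.prod_const, ← Finset.prod_mul_distrib]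
  refine Finset.prod_congr rfl fun i _ => ?_
  rw [Pi.neg_apply, Complex.ofReal_neg, ← neg_add', inv_neg, sub_neg_eq_add, neg_one_mul]

/-- Reversing all poles amounts to the substitution `z ↦ -z`. -/
theorem contour_poles_neg {m : ℕ} (r t : ℝ) (f : Fin m → ℝ) :
    contour r t (poles (-f)) = (-1) ^ (m + 1) * contour r t (poles f) := by
  have : poles (-f) = fun z => (-1) ^ m * poles f (-z) := funext (poles_neg f)
  rw [this, contour_const_mul, contour_comp_neg, pow_succ]
  ring

/-- A product of at least two simple poles inside the circle has no residue at infinity. -/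
theorem contour_zero_poles {m : ℕ} {f : Fin (m + 2) → ℝ} {r : ℝ} (hf : ∀ i, |f i| < r) :
    contour r 0 (poles f) = 0 := by
  have hr : 0 < r := (abs_nonneg _).trans_lt (hf 0)
  -- The circle is blown up; for `R ≥ 2r` all poles have distance at least `R / 2` from it.
  have key : ∀ R : ℝ, 2 * r + 2 ≤ R → ‖∮ z in C(0, r), poles f z‖ ≤ 8 * Real.pi / R := by
    intro R hR
    have hR0 : 0 < R := by linarith
    rw [← Complex.circleIntegral_eq_of_differentiable_on_annulus_off_countable hr
      (by linarith : r ≤ R) Set.countable_empty (f := poles f)]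
    · have hb : ∀ z ∈ Metric.sphere (0 : ℂ) R, ‖poles f z‖ ≤ 4 / R ^ 2 := by
        intro z hz
        have hz' : ‖z‖ = R := by simpa using hz
        have h1 : ∀ i, ‖((f i : ℂ) - z)⁻¹‖ ≤ 2 / R := by
          intro i
          rw [norm_inv, ← one_div_div]
          have : R / 2 ≤ ‖(f i : ℂ) - z‖ := by
            have h2 := norm_sub_norm_le z (f i : ℂ)
            rw [hz', Complex.norm_real, Real.norm_eq_abs, norm_sub_rev] at h2
            have := hf i
            linarith
          rw [← one_div]
          exact one_div_le_one_div_of_le (by positivity) this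
        calc ‖poles f z‖ = ∏ i, ‖((f i : ℂ) - z)⁻¹‖ := norm_prod _ _
          _ ≤ ∏ _i : Fin (m + 2), 2 / R := Finset.prod_le_prod (fun _ _ => norm_nonneg _)
              fun i _ => h1 i
          _ = (2 / R) ^ m * (2 / R) ^ 2 := by rw [Fin.prod_const, pow_add]
          _ ≤ 1 * (2 / R) ^ 2 := by
              gcongr
              refine pow_le_one₀ (by positivity) ?_
              rw [div_le_one hR0]; linarith
          _ = 4 / R ^ 2 := by rw [one_mul, div_pow]; norm_num
      refine (circleIntegral.norm_integral_le_of_norm_le_const hR0.le hb).trans (le_of_eq ?_)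
      field_simp; ring
    · intro z hz
      refine (differentiableAt_poles hf ?_).continuousAt.continuousWithinAt
      simpa using hz.2
    · intro z hz
      refine differentiableAt_poles hf ?_
      have : r < ‖z‖ := by simpa using hz.1.2
      exact this.le
  have hz : (∮ z in C(0, r), poles f z) = 0 := by
    rw [← norm_le_zero_iff]
    have hlim : Tendsto (fun R : ℝ => 8 * Real.pi / R) atTop (𝓝 0) :=
      tendsto_const_nhds.div_atTop tendsto_id
    exact ge_of_tendsto hlim ((eventually_ge_atTop (2 * r + 2)).mono key)
  simp only [contour, Complex.ofReal_zero, neg_zero, zero_mul, Complex.exp_zero, one_mul, hz,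
    mul_zero]

theorem contour_inv_sub {r a : ℝ} (ha : |a| < r) (t : ℝ) :
    contour r t (fun z => ((a : ℂ) - z)⁻¹) = Complex.exp (-t * a ^ 2) := by
  have hd : Differentiable ℂ fun z : ℂ => Complex.exp (-t * z ^ 2) := by fun_prop
  have h := (hd.diffContOnCl (s := Metric.ball (0 : ℂ) r)).circleIntegral_sub_inv_smul
    (w := (a : ℂ)) (by simpa using ha)
  have e : ∀ z : ℂ, Complex.exp (-t * z ^ 2) * ((a : ℂ) - z)⁻¹ =
      -1 * ((z - a)⁻¹ • Complex.exp (-t * z ^ 2)) := by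
    intro z
    rw [← neg_sub z, inv_neg, smul_eq_mul]; ring
  unfold contour
  simp only [e]
  rw [circleIntegral.integral_const_mul, h, smul_eq_mul]
  field_simp [Complex.two_pi_I_ne_zero]

/-! ### Convolution with the heat kernel -/

theorem integral_heat_mul_exp {x : ℝ} {z : ℂ} (h : (x : ℂ) ^ 2 - z ^ 2 ≠ 0) (t : ℝ) :
    ∫ a in (0 : ℝ)..t, heat a 0 x * Complex.exp (-(t - a : ℝ) * z ^ 2) =
      (Complex.exp (-t * z ^ 2) - Complex.exp (-t * x ^ 2)) / (x ^ 2 - z ^ 2) := by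
  have e : ∀ a : ℝ, heat a 0 x * Complex.exp (-(t - a : ℝ) * z ^ 2) =
      Complex.exp (-t * z ^ 2) * Complex.exp (-((x : ℂ) ^ 2 - z ^ 2) * a) := by
    intro a
    simp only [heat, pow_zero, mul_one]
    push_cast
    rw [← Complex.exp_add, ← Complex.exp_add]
    ring_nf
  simp only [e]
  rw [intervalIntegral.integral_const_mul, integral_exp_mul_complex (neg_ne_zero.2 h)]
  have e2 : Complex.exp (-t * x ^ 2) =
      Complex.exp (-t * z ^ 2) * Complex.exp (-((x : ℂ) ^ 2 - z ^ 2) * t) := by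
    rw [← Complex.exp_add]; ring_nf
  rw [e2]
  field_simp
  simp

/-- Convolution with `e^{-t x²}` divides the integrand of the contour functional by `x² - z²`. -/
theorem integral_heat_mul_contour {r x : ℝ} (hx : |x| < r) (t : ℝ) {F : ℂ → ℂ}
    (hF : ContinuousOn F (Metric.sphere 0 r))
    (h0 : contour r 0 (fun z => ((x : ℂ) ^ 2 - z ^ 2)⁻¹ * F z) = 0) :
    ∫ a in (0 : ℝ)..t, heat a 0 x * contour r (t - a) F =
      contour r t fun z => ((x : ℂ) ^ 2 - z ^ 2)⁻¹ * F z := by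
  have hr : 0 < r := (abs_nonneg _).trans_lt hx
  have hne : ∀ z ∈ Metric.sphere (0 : ℂ) r, (x : ℂ) ^ 2 - z ^ 2 ≠ 0 := by
    intro z hz
    have hz' : r ≤ ‖z‖ := by simpa using hz.ge
    rw [sq_sub_sq]
    exact mul_ne_zero (ofReal_add_ne_zero hx hz') (ofReal_sub_ne_zero hx hz')
  have hG : ContinuousOn (fun z => ((x : ℂ) ^ 2 - z ^ 2)⁻¹ * F z) (Metric.sphere 0 r) :=
    (ContinuousOn.inv₀ (by fun_prop) hne).mul hF
  have hmem : ∀ θ, circleMap 0 r θ ∈ Metric.sphere (0 : ℂ) r :=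
    circleMap_mem_sphere 0 hr.le
  have hFc : Continuous fun θ => F (circleMap 0 r θ) :=
    hF.comp_continuous (continuous_circleMap 0 r) hmem
  -- After exchanging the two integrals, the inner one is elementary.
  have hswap : ∫ a in (0 : ℝ)..t, heat a 0 x * ∮ z in C(0, r),
      Complex.exp (-(t - a : ℝ) * z ^ 2) * F z =
      ∮ z in C(0, r), (∫ a in (0 : ℝ)..t, heat a 0 x * Complex.exp (-(t - a : ℝ) * z ^ 2)) *
        F z := by
    simp only [circleIntegral, deriv_circleMap, smul_eq_mul, ← intervalIntegral.integral_const_mul,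
      ← intervalIntegral.integral_mul_const]
    rw [intervalIntegral_intervalIntegral_swap]
    · refine intervalIntegral.integral_congr fun θ _ => intervalIntegral.integral_congr
        fun a _ => ?_
      ring
    · have hcont : Continuous (Function.uncurry fun a θ : ℝ => heat a 0 x *
          (circleMap 0 r θ * Complex.I * (Complex.exp (-(t - a : ℝ) * circleMap 0 r θ ^ 2) *
            F (circleMap 0 r θ)))) := by
        have h1 := hFc.comp (continuous_snd (X := ℝ) (Y := ℝ))
        have h2 := (continuous_circleMap 0 r).comp (continuous_snd (X := ℝ) (Y := ℝ))
        have h3 := (continuous_heat 0 x).comp (continuous_fst (X := ℝ) (Y := ℝ))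
        refine h3.mul ((h2.mul continuous_const).mul (Continuous.mul ?_ h1))
        refine Complex.continuous_exp.comp (Continuous.mul (by fun_prop) (h2.pow 2))
      exact (hcont.continuousOn.integrableOn_compact
        (isCompact_uIcc.prod isCompact_uIcc)).mono_set
          (Set.prod_mono Set.uIoc_subset_uIcc Set.uIoc_subset_uIcc)
  have e : Set.EqOn (fun z : ℂ => (∫ a in (0 : ℝ)..t, heat a 0 x *
      Complex.exp (-(t - a : ℝ) * z ^ 2)) * F z)
      (fun z => Complex.exp (-t * z ^ 2) * (((x : ℂ) ^ 2 - z ^ 2)⁻¹ * F z) -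
        Complex.exp (-t * x ^ 2) * (Complex.exp (-(0 : ℝ) * z ^ 2) *
          (((x : ℂ) ^ 2 - z ^ 2)⁻¹ * F z))) (Metric.sphere 0 r) := by
    intro z hz
    simp only [integral_heat_mul_exp (hne z hz), Complex.ofReal_zero, neg_zero, zero_mul,
      Complex.exp_zero]
    ring
  have h0' := h0
  unfold contour at h0' ⊢
  have h2 : (∮ z in C(0, r), Complex.exp (-(0 : ℝ) * z ^ 2) *
      (((x : ℂ) ^ 2 - z ^ 2)⁻¹ * F z)) = 0 :=
    (mul_eq_zero.1 h0').resolve_left (neg_ne_zero.2 (inv_ne_zero Complex.two_pi_I_ne_zero))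
  have h3 : CircleIntegrable (fun z : ℂ => Complex.exp (-t * x ^ 2) *
      (Complex.exp (-(0 : ℝ) * z ^ 2) * (((x : ℂ) ^ 2 - z ^ 2)⁻¹ * F z))) 0 r :=
    (circleIntegrable_exp_mul hr.le 0 hG).const_smul
  simp only [mul_left_comm (heat _ _ _)]
  rw [intervalIntegral.integral_const_mul, hswap, circleIntegral.integral_congr hr.le e,
    circleIntegral.integral_sub (circleIntegrable_exp_mul hr.le t hG) h3,
    circleIntegral.integral_const_mul, h2, mul_zero, sub_zero]

/-! ### The chains as contour integrals -/

/-- The vector `(x_0, -x_1, x_2, -x_3, ...)`. -/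
def alt {m : ℕ} (x : Fin m → ℝ) : Fin m → ℝ := fun i => (-1) ^ (i : ℕ) * x i

theorem alt_zero {m : ℕ} (x : Fin (m + 1) → ℝ) : alt x 0 = x 0 := by simp [alt]

theorem alt_tail {m : ℕ} (x : Fin (m + 1) → ℝ) : alt (Fin.tail x) = -Fin.tail (alt x) := by
  funext i
  simp [alt, Fin.tail, pow_succ]

theorem alt_neg {m : ℕ} (x : Fin m → ℝ) : alt (-x) = -alt x := by
  funext i
  simp [alt]

theorem abs_alt {m : ℕ} (x : Fin m → ℝ) (i : Fin m) : |alt x i| = |x i| := by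
  simp [alt, abs_mul]

/-- The recursion satisfied by products of simple poles: it matches that of `ψ_n`. -/
theorem integral_heat_mul_contour_poles {m : ℕ} {f : Fin (m + 2) → ℝ} {r : ℝ}
    (hf : ∀ i, |f i| < r) (t : ℝ) :
    ∫ a in (0 : ℝ)..t, heat a 0 (f 0) * contour r (t - a) (fun z =>
      (f 0 + f 1 : ℂ) * poles (Fin.tail f) z - poles (Fin.tail (Fin.tail f)) z) =
    contour r t (poles f) := by
  have hr : 0 < r := (abs_nonneg _).trans_lt (hf 0)
  have e : ∀ z : ℂ, ‖z‖ = r → ((f 0 : ℂ) ^ 2 - z ^ 2)⁻¹ * ((f 0 + f 1 : ℂ) *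
      poles (Fin.tail f) z - poles (Fin.tail (Fin.tail f)) z) = poles f z := by
    intro z hz
    have h1 := ofReal_add_ne_zero (hf 0) hz.ge
    have h2 := ofReal_sub_ne_zero (hf 0) hz.ge
    have h3 := ofReal_sub_ne_zero (hf 1) hz.ge
    have e1 : Fin.tail f 0 = f 1 := rfl
    rw [poles_tail f, poles_tail (Fin.tail f), sq_sub_sq, e1]
    field_simp
    ring
  rw [integral_heat_mul_contour (hf 0), contour_congr hr.le t e]
  · exact ((continuousOn_poles fun i => hf i.succ).const_mul _).sub
      (continuousOn_poles fun i => hf i.succ.succ)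
  · rw [contour_congr hr.le 0 e, contour_zero_poles hf]

/-- `ψ_n(t)(x)` is a contour integral of a product of simple poles at `x_0, -x_1, x_2, ...`. -/
theorem psi_eq_contour (n : ℕ) : ∀ {t : ℝ}, 0 ≤ t → ∀ {x : Fin (n + 1) → ℝ} {r : ℝ},
    (∀ i, |x i| < r) → psi n t x = contour r t (poles (alt x)) := by
  induction n using Nat.twoStepInduction with
  | zero =>
    intro t ht x r hx
    have e : poles (alt x) = fun z => ((x 0 : ℂ) - z)⁻¹ := by
      funext z; simp [poles, alt]
    rw [psi_zero_apply ht, e, contour_inv_sub (hx 0)]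
    simp [heat]
  | one =>
    intro t ht x r hx
    have hr : 0 < r := (abs_nonneg _).trans_lt (hx 0)
    rw [psi_one_apply ht, ← integral_heat_mul_contour_poles fun i => by rw [abs_alt]; exact hx i]
    refine intervalIntegral.integral_congr fun a ha => ?_
    rw [Set.uIcc_of_le ht] at ha
    have hta : 0 ≤ t - a := sub_nonneg.2 ha.2
    have ht1 : ∀ i, |Fin.tail (alt x) i| < r := fun i => by
      rw [Fin.tail, abs_alt]; exact hx _
    -- In place of `ψ_{-1}` there is the empty product, which contributes nothing.
    have hc : contour r (t - a) (poles (Fin.tail (Fin.tail (alt x)))) = 0 :=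
      contour_eq_zero_of_even hr.le _ fun z _ => by simp [poles]
    have hp : psi 0 (t - a) (Fin.tail x) = contour r (t - a) (poles (Fin.tail (alt x))) := by
      have e : poles (Fin.tail (alt x)) = fun z => ((-x 1 : ℝ) - z : ℂ)⁻¹ := by
        funext z; simp [poles, alt, Fin.tail]
      rw [psi_zero_apply hta, e, contour_inv_sub (by simpa using hx 1)]
      simp only [heat, Fin.tail, Fin.succ_zero_eq_one]
      push_cast
      rw [pow_zero, mul_one, neg_sq, neg_mul]
    rw [contour_sub hr.le _ (G := poles (Fin.tail (Fin.tail (alt x))))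
      ((continuousOn_poles ht1).const_mul _) (continuousOn_poles fun i => ht1 i.succ), hc,
      contour_const_mul, hp]
    simp [alt, ← sub_eq_add_neg]
  | more n ih1 ih2 =>
    intro t ht x r hx
    have hr : 0 < r := (abs_nonneg _).trans_lt (hx 0)
    rw [psi_succ_succ_apply n ht, ← integral_heat_mul_contour_poles
      fun i => by rw [abs_alt]; exact hx i]
    refine intervalIntegral.integral_congr fun a ha => ?_
    rw [Set.uIcc_of_le ht] at ha
    have hta : 0 ≤ t - a := sub_nonneg.2 ha.2
    have ht1 : ∀ i, |Fin.tail (alt x) i| < r := fun i => by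
      rw [Fin.tail, abs_alt]; exact hx _
    have e2 : alt (Fin.tail (Fin.tail x)) = Fin.tail (Fin.tail (alt x)) := by
      rw [alt_tail, alt_tail]; funext i; simp [Fin.tail]
    have e3 : (alt x 1 : ℝ) = -x 1 := by simp [alt]
    rw [contour_sub hr.le _ (G := poles (Fin.tail (Fin.tail (alt x))))
      ((continuousOn_poles ht1).const_mul _) (continuousOn_poles fun i => ht1 i.succ),
      contour_const_mul,
      ih2 hta (x := Fin.tail x) (fun i => hx i.succ),
      ih1 hta (x := Fin.tail (Fin.tail x)) (fun i => hx i.succ.succ), e2, alt_tail,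
      contour_poles_neg, alt_zero, e3]
    have e4 : ((-1 : ℂ) ^ (n + 1)) * (-1) ^ (n + 1 + 1 + 1) = 1 := by
      rw [← pow_add]; exact Even.neg_one_pow ⟨n + 2, by ring⟩
    push_cast
    linear_combination (heat a 0 (x 0)) * (x 0 - x 1) *
      contour r (t - a) (poles (Fin.tail (alt x))) * e4

/-- The function `∏_{i < j} 1 / (f_i + z) · 1 / (f_j² - z²) · ∏_{i > j} 1 / (f_i - z)`;
the pole `f_j` is part of the first product below. -/
def mixedPoles {m : ℕ} (j : Fin m) (f : Fin m → ℝ) (z : ℂ) : ℂ :=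
  (∏ i, if i < j then ((f i : ℂ) + z)⁻¹ else ((f i : ℂ) - z)⁻¹) * ((f j : ℂ) + z)⁻¹

theorem psiTilde_eq_contour (n : ℕ) {t : ℝ} (ht : 0 ≤ t) {x : Fin (n + 2) → ℝ} {r : ℝ}
    (hx : ∀ i, |x i| < r) :
    psiTilde (n + 1) t x = (-1) ^ n * contour r t (mixedPoles 0 (alt x)) := by
  have hr : 0 < r := (abs_nonneg _).trans_lt (hx 0)
  have hf : ∀ i, |alt x i| < r := fun i => by rw [abs_alt]; exact hx i
  have e : ∀ z : ℂ, ((alt x 0 : ℂ) ^ 2 - z ^ 2)⁻¹ * poles (Fin.tail (alt x)) z =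
      mixedPoles 0 (alt x) z := by
    intro z
    simp only [mixedPoles, Fin.not_lt_zero, if_false]
    rw [← poles, poles_tail (alt x), sq_sub_sq, mul_inv]
    ring
  rw [psiTilde_succ_apply n ht]
  have e1 : ∀ a ∈ Set.uIcc 0 t, heat a 0 (x 0) * psi n (t - a) (Fin.tail x) =
      (-1) ^ n * (heat a 0 (alt x 0) * contour r (t - a) (poles (Fin.tail (alt x)))) := by
    intro a ha
    rw [Set.uIcc_of_le ht] at ha
    rw [psi_eq_contour n (sub_nonneg.2 ha.2) (x := Fin.tail x) (fun i => hx i.succ), alt_tail,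
      contour_poles_neg,
      alt_zero, pow_add, pow_add]
    ring
  rw [intervalIntegral.integral_congr e1, intervalIntegral.integral_const_mul,
    integral_heat_mul_contour (hf 0) t (F := poles (Fin.tail (alt x)))
      (continuousOn_poles fun i => hf i.succ), contour_congr hr.le t fun z _ => e z]
  -- The integrand has the additional pole `-x_0`, so it is again a product of simple poles.
  rw [contour_congr hr.le 0 (G := fun z => -1 * poles (Fin.cons (-alt x 0) (alt x) :
    Fin (n + 3) → ℝ) z), contour_const_mul, contour_zero_poles, mul_zero]
  · refine Fin.cases ?_ fun i => ?_
    · simpa using hf 0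
    · simpa using hf i
  · intro z hz
    rw [poles_cons, poles_tail (alt x), sq_sub_sq, mul_inv, Complex.ofReal_neg, ← neg_add',
      inv_neg]
    ring

/-! ### The boundary of `ψ_n` and the cyclic orbit of `ψ̃_n` -/

theorem mixedPoles_zero {m : ℕ} (f : Fin (m + 1) → ℝ) (z : ℂ) :
    mixedPoles 0 f z = poles f z * ((f 0 : ℂ) + z)⁻¹ := by
  simp only [mixedPoles, poles, Fin.not_lt_zero, if_false]

theorem mixedPoles_succ {m : ℕ} (j : Fin m) (f : Fin (m + 1) → ℝ) (z : ℂ) :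
    mixedPoles j.succ f z = ((f 0 : ℂ) + z)⁻¹ * mixedPoles j (Fin.tail f) z := by
  simp only [mixedPoles, Fin.prod_univ_succ, Fin.succ_pos, if_true, Fin.succ_lt_succ_iff, Fin.tail,
    mul_assoc]

theorem mixedPoles_neg {m : ℕ} (j : Fin m) (f : Fin m → ℝ) (z : ℂ) :
    mixedPoles j (-f) z = (-1) ^ (m + 1) * mixedPoles j f (-z) := by
  have h1 : ∀ i, (((-f) i : ℝ) + z : ℂ)⁻¹ = -1 * ((f i : ℂ) + -z)⁻¹ := by
    intro i
    rw [Pi.neg_apply, Complex.ofReal_neg, neg_one_mul, ← inv_neg]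
    ring_nf
  have h2 : ∀ i, (((-f) i : ℝ) - z : ℂ)⁻¹ = -1 * ((f i : ℂ) - -z)⁻¹ := by
    intro i
    rw [Pi.neg_apply, Complex.ofReal_neg, neg_one_mul, ← inv_neg]
    ring_nf
  simp only [mixedPoles, h1, h2, ← mul_ite]
  rw [Finset.prod_mul_distrib, Fin.prod_const]
  ring

theorem continuousOn_mixedPoles {m : ℕ} (j : Fin m) {f : Fin m → ℝ} {r : ℝ}
    (hf : ∀ i, |f i| < r) : ContinuousOn (mixedPoles j f) (Metric.sphere 0 r) := by
  have hz : ∀ z ∈ Metric.sphere (0 : ℂ) r, r ≤ ‖z‖ := fun z hz => by simpa using hz.ge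
  have hp : ∀ i, ContinuousOn (fun z : ℂ => ((f i : ℂ) + z)⁻¹) (Metric.sphere 0 r) := fun i =>
    ContinuousOn.inv₀ (by fun_prop) fun z h => ofReal_add_ne_zero (hf i) (hz z h)
  have hm : ∀ i, ContinuousOn (fun z : ℂ => ((f i : ℂ) - z)⁻¹) (Metric.sphere 0 r) := fun i =>
    ContinuousOn.inv₀ (by fun_prop) fun z h => ofReal_sub_ne_zero (hf i) (hz z h)
  refine ContinuousOn.mul (continuousOn_finsetProd _ fun i _ => ?_) (hp j)
  split_ifs
  · exact hp i
  · exact hm i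

/-- The sum telescopes since `2z / (f_j² - z²) = 1 / (f_j - z) - 1 / (f_j + z)`. -/
theorem two_mul_sum_mixedPoles {m : ℕ} {r : ℝ} {z : ℂ} (hz : ‖z‖ = r) :
    ∀ {f : Fin m → ℝ}, (∀ i, |f i| < r) →
      2 * z * ∑ j, mixedPoles j f z = poles f z - poles f (-z) := by
  induction m with
  | zero => intro f _; simp [poles]
  | succ m ih =>
    intro f hf
    have h := ih (f := Fin.tail f) fun i => hf i.succ
    have h1 := ofReal_add_ne_zero (hf 0) hz.ge
    have h2 := ofReal_sub_ne_zero (hf 0) hz.ge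
    rw [Fin.sum_univ_succ, mixedPoles_zero]
    simp only [mixedPoles_succ]
    rw [← Finset.mul_sum, poles_tail f, poles_tail f, mul_add, mul_left_comm _ (_)⁻¹ (∑ _, _), h,
      sub_neg_eq_add]
    field_simp
    ring

theorem sum_contour_mixedPoles {m : ℕ} {r : ℝ} (hr : 0 < r) (t : ℝ) {f : Fin m → ℝ}
    (hf : ∀ i, |f i| < r) : ∑ j, contour r t (mixedPoles j f) = 0 := by
  rw [← contour_sum hr.le t _ fun j _ => continuousOn_mixedPoles j hf]
  refine contour_eq_zero_of_even hr.le t fun z hz => ?_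
  have hz0 : z ≠ 0 := by
    rintro rfl
    simp at hz
    exact hr.ne hz
  have h1 := two_mul_sum_mixedPoles hz hf
  have h2 := two_mul_sum_mixedPoles (z := -z) (by simpa using hz) hf
  rw [neg_neg] at h2
  have h3 : (2 * z) ≠ 0 := mul_ne_zero two_ne_zero hz0
  refine mul_left_cancel₀ h3 ?_
  linear_combination -h2 - h1

theorem neg_one_pow_mul_prod_ite {m : ℕ} (k : Fin m) :
    (-1 : ℂ) ^ (k : ℕ) * ∏ i : Fin m, (if i < k then (1 : ℂ) else -1) = (-1) ^ m := by
  have h : (-1 : ℂ) ^ (k : ℕ) = ∏ i : Fin m, (if i < k then (-1 : ℂ) else 1) := by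
    rw [Finset.prod_ite, Finset.prod_const, Finset.prod_const_one, mul_one,
      Finset.filter_gt_eq_Iio, Fin.card_Iio]
  rw [h, ← Finset.prod_mul_distrib, ← Fin.prod_const]
  refine Finset.prod_congr rfl fun i _ => ?_
  split_ifs <;> simp

/-- Multiplying two neighbouring factors repeats a variable with the opposite sign. -/
theorem poles_alt_comp_predAbove {n : ℕ} (k : Fin (n + 1)) (x : Fin (n + 1) → ℝ) (z : ℂ) :
    (-1) ^ (k : ℕ) * poles (alt (x ∘ k.predAbove)) z =
      (-1) ^ (n + 1) * mixedPoles k (alt x) (-z) := by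
  have h1 : ∀ i : Fin (n + 1),
      ((alt (x ∘ k.predAbove) (k.castSucc.succAbove i) : ℝ) - z : ℂ)⁻¹ =
      (if i < k then (1 : ℂ) else -1) *
        if i < k then ((alt x i : ℂ) + -z)⁻¹ else ((alt x i : ℂ) - -z)⁻¹ := by
    intro i
    simp only [alt, Function.comp, Fin.predAbove_succAbove]
    split_ifs with h
    · rw [Fin.succAbove_of_castSucc_lt _ _ (by simpa using h)]
      simp [sub_eq_add_neg]
    · rw [Fin.succAbove_of_le_castSucc _ _ (by simpa using h), neg_one_mul, ← inv_neg]
      simp only [Fin.val_succ, pow_succ]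
      push_cast
      ring_nf
  rw [poles, Fin.prod_univ_succAbove _ k.castSucc]
  simp only [h1]
  rw [Finset.prod_mul_distrib, ← neg_one_pow_mul_prod_ite k, mixedPoles]
  simp only [alt, Function.comp, Fin.predAbove_castSucc_self, Fin.val_castSucc]
  ring

/-- For a function of total parity `q`, the sign rule of `koszul` amounts to a sign in the
moved variable. -/
theorem koszul_of_parity {n : ℕ} {g : Fun n} {q : ℕ} (hg : ∀ x, g (-x) = (-1) ^ q * g x)
    (y : Fin n → ℝ) (z : ℝ) : koszul g y z = g (Fin.snoc y ((-1) ^ (q + 1) * z)) := by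
  have h : ∀ w : ℝ, (Fin.snoc (-y) w : Fin (n + 1) → ℝ) = -Fin.snoc y (-w) := by
    intro w
    funext i
    refine Fin.lastCases ?_ (fun i => ?_) i <;> simp
  rw [koszul, h, h, hg, hg, neg_neg, pow_succ]
  rcases neg_one_pow_eq_or ℂ q with hq | hq
  · have hq' : (-1 : ℝ) ^ q = 1 := by exact_mod_cast hq
    rw [hq, hq', one_mul, mul_neg_one, neg_one_mul]; ring
  · have hq' : (-1 : ℝ) ^ q = -1 := by exact_mod_cast hq
    rw [hq, hq', neg_mul_neg, one_mul, one_mul]; ring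

theorem exists_abs_lt {m : ℕ} (x : Fin m → ℝ) : ∃ r, 0 < r ∧ ∀ i, |x i| < r := by
  refine ⟨∑ i, |x i| + 1, by positivity, fun i => ?_⟩
  have := Finset.single_le_sum (fun i _ => abs_nonneg (x i)) (Finset.mem_univ i)
  linarith

theorem psi_neg (n : ℕ) {t : ℝ} (ht : 0 ≤ t) (x : Fin (n + 1) → ℝ) :
    psi n t (-x) = (-1) ^ n * psi n t x := by
  obtain ⟨r, -, hx⟩ := exists_abs_lt x
  rw [psi_eq_contour n ht hx, psi_eq_contour n ht (x := -x) (r := r) (by simpa using hx), alt_neg,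
    contour_poles_neg]
  ring

theorem hochschild_psi_apply (n : ℕ) {t : ℝ} (ht : 0 ≤ t) {x : Fin (n + 1) → ℝ} {r : ℝ}
    (hx : ∀ i, |x i| < r) :
    hochschild n (psi (n + 1) t) x = (-1) ^ n * contour r t (mixedPoles 0 (alt x)) := by
  have hr : 0 < r := (abs_nonneg _).trans_lt (hx 0)
  have hf : ∀ i, |alt x i| < r := fun i => by rw [abs_alt]; exact hx i
  have h1 : ∑ k : Fin (n + 1), (-1) ^ (k : ℕ) * psi (n + 1) t (x ∘ k.predAbove) = 0 := by
    have e : ∀ k : Fin (n + 1), (-1) ^ (k : ℕ) * psi (n + 1) t (x ∘ k.predAbove) =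
        (-1) ^ n * contour r t (mixedPoles k (alt x)) := by
      intro k
      rw [psi_eq_contour (n + 1) ht (x := x ∘ k.predAbove) (r := r) fun i => hx _,
        ← contour_const_mul]
      simp only [poles_alt_comp_predAbove]
      rw [contour_const_mul, contour_comp_neg]
      ring
    simp only [e]
    rw [← Finset.mul_sum, sum_contour_mixedPoles hr t hf, mul_zero]
  have h2 : koszul (psi (n + 1) t) x (x 0) = -contour r t (mixedPoles 0 (alt x)) := by
    rw [koszul_of_parity (psi_neg (n + 1) ht), psi_eq_contour (n + 1) ht (r := r),
      ← neg_one_mul (contour _ _ _), ← contour_const_mul]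
    · congr 1
      funext z
      have e : (alt (Fin.snoc x ((-1) ^ (n + 1 + 1) * x 0) : Fin (n + 2) → ℝ)
          (Fin.last (n + 1)) : ℝ) = -alt x 0 := by
        simp only [alt, Fin.val_last, Fin.snoc_last, ← mul_assoc, ← pow_add, Fin.val_zero,
          pow_zero, one_mul]
        rw [Odd.neg_one_pow ⟨n + 1, by ring⟩, neg_one_mul]
      rw [mixedPoles_zero, poles, Fin.prod_univ_castSucc, e]
      have e2 : ∀ i : Fin (n + 1), alt (Fin.snoc x ((-1) ^ (n + 1 + 1) * x 0) : Fin (n + 2) → ℝ)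
          i.castSucc = alt x i := by
        intro i; simp [alt]
      simp only [e2]
      rw [Complex.ofReal_neg, ← neg_add', inv_neg, poles]
      ring
    · intro i
      refine Fin.lastCases ?_ (fun i => ?_) i
      · simpa [abs_mul] using hx 0
      · simpa using hx i
  have h3 : hochschild n (psi (n + 1) t) x =
      ∑ k : Fin (n + 1), (-1) ^ (k : ℕ) * psi (n + 1) t (x ∘ k.predAbove) +
        (-1) ^ (n + 1) * koszul (psi (n + 1) t) x (x 0) := rfl
  rw [h3, h1, h2]
  ring

theorem hochschild_psi (n : ℕ) {t : ℝ} (ht : 0 ≤ t) :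
    hochschild n (psi (n + 1) t) = -psiTilde n t := by
  funext x
  obtain ⟨r, hr, hx⟩ := exists_abs_lt x
  rw [hochschild_psi_apply n ht hx, Pi.neg_apply]
  rcases n with _ | n
  · have h := sum_contour_mixedPoles hr t (f := alt x) fun i => by rw [abs_alt]; exact hx i
    rw [Fin.sum_univ_one] at h
    rw [h]
    simp [psiTilde]
  · rw [psiTilde_eq_contour n ht hx]
    ring

/-- The cyclic operator moves the pair of poles `± f_j` to the next variable. -/
theorem cyc_apply_of_eq_contour {n : ℕ} {t : ℝ} {v : Fun n} {c : ℂ} (j : Fin n)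
    (hv : ∀ x r, (∀ i, |x i| < r) → v x = c * contour r t (mixedPoles j.castSucc (alt x)))
    (x : Fin (n + 1) → ℝ) (r : ℝ) (hx : ∀ i, |x i| < r) :
    cyc n v x = c * contour r t (mixedPoles j.succ (alt x)) := by
  have hpar : ∀ x, v (-x) = (-1) ^ (n + 1) * v x := by
    intro x
    obtain ⟨r, -, hx⟩ := exists_abs_lt x
    rw [hv x r hx, hv (-x) r (by simpa using hx), alt_neg]
    have e : mixedPoles j.castSucc (-alt x) =
        fun z => (-1) ^ (n + 1 + 1) * mixedPoles j.castSucc (alt x) (-z) :=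
      funext fun z => mixedPoles_neg _ _ z
    rw [e, contour_const_mul, contour_comp_neg]
    ring
  have h1 : cyc n v x = (-1) ^ n * koszul v (Fin.tail x) (x 0) := rfl
  rw [h1, koszul_of_parity hpar, hv _ r]
  · set y : Fin (n + 1) → ℝ := Fin.snoc (Fin.tail x) ((-1) ^ (n + 1 + 1) * x 0) with hy
    have e1 : ∀ i : Fin n, alt y i.castSucc = -alt x i.succ := by
      intro i
      simp [alt, hy, Fin.tail, pow_succ]
    have e2 : alt y (Fin.last n) = alt x 0 := by
      simp only [alt, hy, Fin.val_last, Fin.snoc_last, ← mul_assoc, ← pow_add, Fin.val_zero,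
        pow_zero, one_mul]
      rw [Even.neg_one_pow ⟨n + 1, by ring⟩, one_mul]
    have e3 : mixedPoles j.castSucc (alt y) =
        fun z => (-1) ^ (n + 1) * mixedPoles j.succ (alt x) (-z) := by
      funext z
      rw [mixedPoles_succ, ← mul_left_comm, ← mixedPoles_neg]
      simp only [mixedPoles, Fin.prod_univ_castSucc, e1, e2, Fin.castSucc_lt_castSucc_iff,
        Pi.neg_apply, Fin.tail, Fin.not_lt.2 (Fin.le_last _), if_false]
      rw [← sub_eq_add_neg]
      ring
    rw [e3, contour_const_mul, contour_comp_neg]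
    have e4 : (-1 : ℂ) ^ n * (-1) ^ (n + 1) = -1 := by
      rw [← pow_add]; exact Odd.neg_one_pow ⟨n, by ring⟩
    linear_combination -c * contour r t (mixedPoles j.succ (alt x)) * e4
  · intro i
    refine Fin.lastCases ?_ (fun i => ?_) i
    · simpa [abs_mul] using hx 0
    · simpa [Fin.tail] using hx i.succ

theorem cyc_pow_psiTilde_apply (n : ℕ) {t : ℝ} (ht : 0 ≤ t) (j : ℕ) (hj : j < n + 2) :
    ∀ (x : Fin (n + 2) → ℝ) (r : ℝ), (∀ i, |x i| < r) →
      (cyc (n + 1) ^ j) (psiTilde (n + 1) t) x =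
        (-1) ^ n * contour r t (mixedPoles ⟨j, hj⟩ (alt x)) := by
  induction j with
  | zero => intro x r hx; exact psiTilde_eq_contour n ht hx
  | succ j ih =>
    intro x r hx
    rw [pow_succ']
    exact cyc_apply_of_eq_contour ⟨j, by omega⟩ (ih (by omega)) x r hx

/-- The iterates of `ψ̃_n` under `t_n` move the pair of poles `± f_j` through all variables. -/
theorem sum_cyc_pow_psiTilde (n : ℕ) {t : ℝ} (ht : 0 ≤ t) :
    ∑ j ∈ Finset.range (n + 2), (cyc (n + 1) ^ j) (psiTilde (n + 1) t) = 0 := by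
  funext x
  obtain ⟨r, hr, hx⟩ := exists_abs_lt x
  rw [Finset.sum_apply, Finset.sum_range]
  have e : ∀ j : Fin (n + 2), (cyc (n + 1) ^ (j : ℕ)) (psiTilde (n + 1) t) x =
      (-1) ^ n * contour r t (mixedPoles j (alt x)) := fun j =>
    cyc_pow_psiTilde_apply n ht j j.2 x r hx
  simp only [e]
  rw [← Finset.mul_sum, sum_contour_mixedPoles hr t fun i => by rw [abs_alt]; exact hx i, mul_zero,
    Pi.zero_apply]

/-- A vector whose first `N + 1` iterates under `T` sum to zero is in the image of `1 - T`. -/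
theorem mem_map_one_sub_of_sum_pow_eq_zero {V : Type*} [AddCommGroup V] [Module ℂ V]
    (T : V →ₗ[ℂ] V) (p : Submodule ℂ V) {v : V} (N : ℕ) (hp : ∀ i, (T ^ i) v ∈ p)
    (h : ∑ j ∈ Finset.range (N + 1), (T ^ j) v = 0) : v ∈ p.map (LinearMap.id - T) := by
  have h1 : ∀ j, (LinearMap.id - T : V →ₗ[ℂ] V) (∑ i ∈ Finset.range j, (T ^ i) v) =
      v - (T ^ j) v := by
    intro j
    have e : ∀ i, (LinearMap.id - T : V →ₗ[ℂ] V) ((T ^ i) v) = (T ^ i) v - (T ^ (i + 1)) v := by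
      intro i; rw [pow_succ']; rfl
    simp only [map_sum, e]
    rw [Finset.sum_range_sub', pow_zero]; rfl
  -- `v` is the mean of the differences `v - T^j v`, each of which telescopes.
  refine ⟨((N : ℂ) + 1)⁻¹ • ∑ j ∈ Finset.range (N + 1), ∑ i ∈ Finset.range j, (T ^ i) v,
    p.smul_mem _ (p.sum_mem fun j _ => p.sum_mem fun i _ => hp i), ?_⟩
  rw [map_smul, map_sum]
  simp only [h1]
  rw [Finset.sum_sub_distrib, h, sub_zero, Finset.sum_const, Finset.card_range,
    ← Nat.cast_smul_eq_nsmul ℂ, smul_smul]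
  push_cast
  rw [inv_mul_cancel₀ (by exact_mod_cast N.succ_ne_zero), one_smul]

/-! ### Seminorms of the functions `e^{-s x²} x^i` -/

/-- The `k`-th derivative of `e^{-s x²} x^i`, by recursion on `k`. For `i = 0` the truncated exponent
`i - 1` comes with the coefficient `0`. -/
def dHeat : ℕ → ℝ → ℕ → ℝ → ℂ
  | 0, s, i, x => heat s i x
  | k + 1, s, i, x => i * dHeat k s (i - 1) x - 2 * s * dHeat k s (i + 1) x

theorem hasDerivAt_dHeat (k : ℕ) (s : ℝ) (i : ℕ) (x : ℝ) :
    HasDerivAt (dHeat k s i) (dHeat (k + 1) s i x) x := by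
  induction k generalizing i with
  | zero =>
    have h1 : HasDerivAt (fun x : ℝ => Real.exp (-(s * x ^ 2)))
        (Real.exp (-(s * x ^ 2)) * (-(s * (2 * x)))) x := by
      have := ((hasDerivAt_pow 2 x).const_mul s).neg.exp
      simpa using this
    have h2 := (h1.mul (hasDerivAt_pow i x)).ofReal_comp
    refine h2.congr_deriv ?_
    change _ = (i : ℂ) * heat s (i - 1) x - 2 * s * heat s (i + 1) x
    simp only [heat]
    push_cast
    ring
  | succ k ih => exact ((ih (i - 1)).const_mul _).sub ((ih (i + 1)).const_mul _)

theorem iteratedDeriv_heat (k : ℕ) (s : ℝ) (i : ℕ) : iteratedDeriv k (heat s i) = dHeat k s i := by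
  induction k with
  | zero => rw [iteratedDeriv_zero]; rfl
  | succ k ih => rw [iteratedDeriv_succ, ih]; exact funext fun x => (hasDerivAt_dHeat k s i x).deriv

theorem contDiff_heat (s : ℝ) (i : ℕ) : ContDiff ℝ ∞ (heat s i) := by
  have : ContDiff ℝ ∞ fun x : ℝ => Real.exp (-(s * x ^ 2)) * x ^ i := by fun_prop
  exact Complex.ofRealCLM.contDiff.comp this

theorem hasDerivAt_dHeat_left (k : ℕ) (s : ℝ) (i : ℕ) (x : ℝ) :
    HasDerivAt (fun s => dHeat k s i x) (-dHeat k s (i + 2) x) s := by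
  induction k generalizing i with
  | zero =>
    have h1 : HasDerivAt (fun s : ℝ => Real.exp (-(s * x ^ 2)))
        (Real.exp (-(s * x ^ 2)) * (-(1 * x ^ 2))) s :=
      ((hasDerivAt_id s).mul_const (x ^ 2)).neg.exp
    have h2 := (h1.mul_const (x ^ i)).ofReal_comp
    refine h2.congr_deriv ?_
    change _ = -heat s (i + 2) x
    simp only [heat]
    push_cast
    ring
  | succ k ih =>
    have h2 : HasDerivAt (fun s : ℝ => (2 * s : ℂ)) 2 s := by
      simpa using (hasDerivAt_id s).ofReal_comp.const_mul (2 : ℂ)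
    have h := ((ih (i - 1)).const_mul (i : ℂ)).sub (h2.mul (ih (i + 1)))
    refine h.congr_deriv ?_
    simp only [dHeat]
    rcases i with _ | i
    · push_cast
      ring
    · push_cast
      ring

theorem sq_one_add_abs_le (x : ℝ) : (1 + |x|) ^ 2 ≤ 2 * (1 + x ^ 2) := by
  nlinarith [sq_nonneg (1 - |x|), sq_abs x]

theorem norm_heat (s : ℝ) (i : ℕ) (x : ℝ) :
    ‖heat s i x‖ = Real.exp (-(s * x ^ 2)) * |x| ^ i := by
  rw [heat, Complex.norm_real, Real.norm_eq_abs, abs_mul, abs_pow, abs_of_pos (Real.exp_pos _)]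

theorem pow_le_factorial_mul_exp {y : ℝ} (hy : 0 ≤ y) (q : ℕ) :
    y ^ q ≤ q.factorial * Real.exp y := by
  have := Real.pow_div_factorial_le_exp y hy q
  rwa [div_le_iff₀' (by positivity)] at this

/-- The factor `s^q` trades for `2q` powers of `1 + |x|`, uniformly in `s ∈ [0, t]`. -/
theorem exists_norm_dHeat_le_zpow (t : ℝ) (k i q : ℕ) : ∃ B : ℝ, 0 ≤ B ∧
    ∀ s ∈ Set.Icc 0 t, ∀ x : ℝ,
      s ^ q * ‖dHeat k s i x‖ ≤ B * (1 + |x|) ^ ((i : ℤ) - k - 2 * q) := by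
  induction k generalizing i q with
  | zero =>
    refine ⟨2 ^ q * (q.factorial * Real.exp t), by positivity, fun s hs x => ?_⟩
    have h0 : (0 : ℝ) < 1 + |x| := by positivity
    have hs0 := hs.1
    have h1 : s ^ q * (1 + |x|) ^ (2 * q) ≤
        2 ^ q * (q.factorial * (Real.exp t * Real.exp (s * x ^ 2))) := by
      calc s ^ q * (1 + |x|) ^ (2 * q) = (s * (1 + |x|) ^ 2) ^ q := by rw [mul_pow, pow_mul]
        _ ≤ (s * (2 * (1 + x ^ 2))) ^ q := by gcongr; exact sq_one_add_abs_le x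
        _ = 2 ^ q * (s + s * x ^ 2) ^ q := by rw [← mul_pow]; ring
        _ ≤ 2 ^ q * (q.factorial * Real.exp (s + s * x ^ 2)) := by
          gcongr; exact pow_le_factorial_mul_exp (by positivity) q
        _ ≤ 2 ^ q * (q.factorial * (Real.exp t * Real.exp (s * x ^ 2))) := by
          rw [Real.exp_add]; gcongr; exact hs.2
    have e : (1 + |x|) ^ ((i : ℤ) - (0 : ℕ) - 2 * q) = (1 + |x|) ^ i / (1 + |x|) ^ (2 * q) := by
      rw [Nat.cast_zero, sub_zero, zpow_sub₀ h0.ne', zpow_natCast]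
      norm_cast
    have h2 : |x| ^ i ≤ (1 + |x|) ^ i := by gcongr; linarith
    rw [e, dHeat, norm_heat, mul_div_assoc', le_div_iff₀ (by positivity)]
    have h3 : Real.exp (s * x ^ 2) * Real.exp (-(s * x ^ 2)) = 1 := by
      rw [← Real.exp_add, add_neg_cancel, Real.exp_zero]
    calc s ^ q * (Real.exp (-(s * x ^ 2)) * |x| ^ i) * (1 + |x|) ^ (2 * q)
        = (s ^ q * (1 + |x|) ^ (2 * q)) * Real.exp (-(s * x ^ 2)) * |x| ^ i := by ring
      _ ≤ (2 ^ q * (q.factorial * (Real.exp t * Real.exp (s * x ^ 2)))) *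
          Real.exp (-(s * x ^ 2)) * (1 + |x|) ^ i := by gcongr
      _ = 2 ^ q * (q.factorial * Real.exp t) * (1 + |x|) ^ i *
          (Real.exp (s * x ^ 2) * Real.exp (-(s * x ^ 2))) := by ring
      _ = _ := by rw [h3, mul_one]
  | succ k ih =>
    obtain ⟨B1, hB1, h1⟩ := ih (i - 1) q
    obtain ⟨B2, hB2, h2⟩ := ih (i + 1) (q + 1)
    refine ⟨i * B1 + 2 * B2, by positivity, fun s hs x => ?_⟩
    have hs0 := hs.1
    have e1 : (i : ℝ) * (s ^ q * ‖dHeat k s (i - 1) x‖) ≤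
        i * (B1 * (1 + |x|) ^ ((i : ℤ) - (k + 1 : ℕ) - 2 * q)) := by
      rcases i with _ | i
      · simp
      · have := h1 s hs x
        rw [Nat.add_sub_cancel] at this
        have e : ((i + 1 : ℕ) : ℤ) - (k + 1 : ℕ) - 2 * q = (i : ℤ) - k - 2 * q := by
          push_cast; ring
        rw [e]
        exact mul_le_mul_of_nonneg_left this (by positivity)
    have e2 : s ^ (q + 1) * ‖dHeat k s (i + 1) x‖ ≤
        B2 * (1 + |x|) ^ ((i : ℤ) - (k + 1 : ℕ) - 2 * q) := by
      have e : ((i + 1 : ℕ) : ℤ) - k - 2 * (q + 1 : ℕ) = (i : ℤ) - (k + 1 : ℕ) - 2 * q := by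
        push_cast; ring
      rw [← e]
      exact h2 s hs x
    have e3 : ‖dHeat (k + 1) s i x‖ ≤
        i * ‖dHeat k s (i - 1) x‖ + 2 * s * ‖dHeat k s (i + 1) x‖ := by
      refine (norm_sub_le _ _).trans (le_of_eq ?_)
      rw [norm_mul, norm_mul, norm_mul, Complex.norm_natCast, Complex.norm_real,
        Real.norm_of_nonneg hs0]
      norm_num
    calc s ^ q * ‖dHeat (k + 1) s i x‖
        ≤ s ^ q * (i * ‖dHeat k s (i - 1) x‖ + 2 * s * ‖dHeat k s (i + 1) x‖) := by gcongr
      _ = i * (s ^ q * ‖dHeat k s (i - 1) x‖) + 2 * (s ^ (q + 1) * ‖dHeat k s (i + 1) x‖) := by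
          ring
      _ ≤ _ := add_le_add e1 (mul_le_mul_of_nonneg_left e2 zero_le_two)
      _ = _ := by ring

/-- A bound that keeps the Gaussian decay, used for the spaces `𝓓_{1/m}`. -/
theorem exists_norm_dHeat_le_exp (t : ℝ) (k i : ℕ) : ∃ B : ℝ, 0 ≤ B ∧
    ∀ s ∈ Set.Icc 0 t, ∀ x : ℝ,
      ‖dHeat k s i x‖ ≤ B * (1 + |x|) ^ (i + k) * Real.exp (-(s * x ^ 2)) := by
  induction k generalizing i with
  | zero =>
    refine ⟨1, zero_le_one, fun s hs x => ?_⟩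
    rw [dHeat, norm_heat, one_mul, mul_comm, add_zero]
    gcongr
    linarith
  | succ k ih =>
    obtain ⟨B1, hB1, h1⟩ := ih (i - 1)
    obtain ⟨B2, hB2, h2⟩ := ih (i + 1)
    refine ⟨i * B1 + 2 * |t| * B2, by positivity, fun s hs x => ?_⟩
    have hx : (1 : ℝ) ≤ 1 + |x| := by linarith [abs_nonneg x]
    have hst : s ≤ |t| := hs.2.trans (le_abs_self t)
    have hs0 := hs.1
    calc ‖dHeat (k + 1) s i x‖ ≤
        i * ‖dHeat k s (i - 1) x‖ + 2 * s * ‖dHeat k s (i + 1) x‖ := by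
          refine (norm_sub_le _ _).trans (le_of_eq ?_)
          rw [norm_mul, norm_mul, norm_mul, Complex.norm_natCast, Complex.norm_real,
            Real.norm_of_nonneg hs0]
          norm_num
      _ ≤ i * (B1 * (1 + |x|) ^ (i + (k + 1)) * Real.exp (-(s * x ^ 2))) +
          2 * |t| * (B2 * (1 + |x|) ^ (i + (k + 1)) * Real.exp (-(s * x ^ 2))) := by
          gcongr
          · refine (h1 s hs x).trans ?_
            gcongr
            all_goals first | exact hx | omega
          · refine (h2 s hs x).trans (le_of_eq ?_)
            ring_nf
      _ = _ := by ring

theorem symbolSeminorm_le {m N : ℕ} {f : ℝ → ℂ} {c : ℝ} (hc : 0 ≤ c) {B : ℕ → ℝ}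
    (h : ∀ k x, ‖iteratedDeriv k f x‖ ≤ c * (B k * (1 + |x|) ^ ((m : ℤ) - k))) :
    symbolSeminorm m N f ≤ ENNReal.ofReal c *
      ∑ k ∈ Finset.range (N + 1), ENNReal.ofReal (B k) := by
  unfold symbolSeminorm
  rw [Finset.mul_sum]
  refine Finset.sum_le_sum fun k _ => iSup_le fun x => ?_
  have h0 : (0 : ℝ) < 1 + |x| := by positivity
  rw [← ENNReal.ofReal_mul hc, ← ofReal_norm, ← ENNReal.ofReal_mul (norm_nonneg _)]
  refine ENNReal.ofReal_le_ofReal ?_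
  calc ‖iteratedDeriv k f x‖ * (1 + |x|) ^ ((k : ℤ) - m)
      ≤ c * (B k * (1 + |x|) ^ ((m : ℤ) - k)) * (1 + |x|) ^ ((k : ℤ) - m) := by
        gcongr; exact h k x
    _ = c * B k * ((1 + |x|) ^ ((m : ℤ) - k) * (1 + |x|) ^ ((k : ℤ) - m)) := by ring
    _ = c * B k := by rw [← zpow_add₀ h0.ne']; simp

theorem decaySeminorm_le {m N : ℕ} {f : ℝ → ℂ} {c : ℝ} (hc : 0 ≤ c) {w : ℕ → ℝ → ℝ}
    (h : ∀ k x, ‖iteratedDeriv k f x‖ ≤ c * w k x) :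
    decaySeminorm m N f ≤ ENNReal.ofReal c * ∑ k ∈ Finset.range (N + 1),
      (∫⁻ x : ℝ, ENNReal.ofReal (Real.exp (1 / (m : ℝ) * x ^ 2)) * ENNReal.ofReal (w k x) ^ 2)
        ^ (1 / 2 : ℝ) := by
  unfold decaySeminorm
  rw [Finset.mul_sum]
  refine Finset.sum_le_sum fun k _ => ?_
  have e : ENNReal.ofReal c = (ENNReal.ofReal c ^ 2) ^ (1 / 2 : ℝ) := by
    rw [← ENNReal.rpow_natCast, ← ENNReal.rpow_mul]; norm_num
  rw [e, ← ENNReal.mul_rpow_of_nonneg _ _ (by norm_num),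
    ← lintegral_const_mul' _ _ (by finiteness)]
  refine ENNReal.rpow_le_rpow (lintegral_mono fun x => ?_) (by norm_num)
  rw [mul_left_comm, ← mul_pow, ← ENNReal.ofReal_mul hc, ← ofReal_norm]
  gcongr
  exact h k x

theorem lintegral_decay_lt_top {m : ℕ} {s₀ : ℝ} (hs₀ : 0 < s₀) (hm : 1 / (m : ℝ) ≤ s₀) {B : ℝ}
    (hB : 0 ≤ B) (d : ℕ) : ∫⁻ x : ℝ, ENNReal.ofReal (Real.exp (1 / (m : ℝ) * x ^ 2)) *
      ENNReal.ofReal (B * (1 + |x|) ^ d * Real.exp (-(s₀ * x ^ 2))) ^ 2 < ⊤ := by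
  -- Half of the exponent absorbs the polynomial factor, the other half stays.
  set D : ℝ := B ^ 2 * ((2 * (2 / s₀)) ^ d * (d.factorial * Real.exp (s₀ / 2))) with hD
  have hi : Integrable fun x : ℝ => D * Real.exp (-(s₀ / 2) * x ^ 2) :=
    (integrable_exp_neg_mul_sq (by positivity)).const_mul D
  refine lt_of_le_of_lt (lintegral_mono fun x => ?_) hi.lintegral_lt_top
  have h0 : (0 : ℝ) ≤ Real.exp (1 / (m : ℝ) * x ^ 2) := (Real.exp_pos _).le
  rw [← ENNReal.ofReal_pow (by positivity), ← ENNReal.ofReal_mul h0]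
  refine ENNReal.ofReal_le_ofReal ?_
  have h1 : ((1 + |x|) ^ d) ^ 2 ≤ (2 * (2 / s₀)) ^ d *
      (d.factorial * Real.exp (s₀ / 2 * (1 + x ^ 2))) := by
    calc ((1 + |x|) ^ d) ^ 2 = ((1 + |x|) ^ 2) ^ d := by rw [← pow_mul, ← pow_mul, mul_comm]
      _ ≤ (2 * (1 + x ^ 2)) ^ d := by gcongr; exact sq_one_add_abs_le x
      _ = (2 * (2 / s₀)) ^ d * (s₀ / 2 * (1 + x ^ 2)) ^ d := by
        rw [← mul_pow]; congr 1; field_simp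
      _ ≤ _ := by gcongr; exact pow_le_factorial_mul_exp (by positivity) d
  have h2 : Real.exp (1 / (m : ℝ) * x ^ 2) ≤ Real.exp (s₀ * x ^ 2) := by gcongr
  calc Real.exp (1 / (m : ℝ) * x ^ 2) * (B * (1 + |x|) ^ d * Real.exp (-(s₀ * x ^ 2))) ^ 2
      = B ^ 2 * ((1 + |x|) ^ d) ^ 2 *
        (Real.exp (1 / (m : ℝ) * x ^ 2) * Real.exp (-(s₀ * x ^ 2)) ^ 2) := by ring
    _ ≤ B ^ 2 * ((2 * (2 / s₀)) ^ d * (d.factorial * Real.exp (s₀ / 2 * (1 + x ^ 2)))) *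
        (Real.exp (s₀ * x ^ 2) * Real.exp (-(s₀ * x ^ 2)) ^ 2) := by gcongr
    _ = D * (Real.exp (s₀ / 2 * x ^ 2) * (Real.exp (s₀ * x ^ 2) *
        Real.exp (-(s₀ * x ^ 2)) ^ 2)) := by
        rw [hD, mul_add (s₀ / 2), Real.exp_add, mul_one]; ring
    _ = D * Real.exp (-(s₀ / 2) * x ^ 2) := by
        rw [← Real.exp_nat_mul, ← Real.exp_add, ← Real.exp_add]; congr 2; push_cast; ring

/-- The mean value inequality in `s`, where `∂_s` raises the exponent by two. -/
theorem norm_iteratedDeriv_heat_sub_le {a t : ℝ} {k i : ℕ} {x w : ℝ}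
    (h : ∀ s ∈ Set.Icc a t, ‖dHeat k s (i + 2) x‖ ≤ w) {s s' : ℝ} (hs : s ∈ Set.Icc a t)
    (hs' : s' ∈ Set.Icc a t) :
    ‖iteratedDeriv k (heat s i - heat s' i) x‖ ≤ |s - s'| * w := by
  have e : iteratedDeriv k (heat s i - heat s' i) x = dHeat k s i x - dHeat k s' i x := by
    rw [iteratedDeriv_sub ((contDiff_heat s i).contDiffAt.of_le (by exact_mod_cast le_top))
      ((contDiff_heat s' i).contDiffAt.of_le (by exact_mod_cast le_top)),
      iteratedDeriv_heat, iteratedDeriv_heat]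
  rw [e, mul_comm]
  exact Convex.norm_image_sub_le_of_norm_hasDerivWithin_le
    (fun s _ => (hasDerivAt_dHeat_left k s i x).hasDerivWithinAt)
    (fun s hs => by rw [norm_neg]; exact h s hs) (convex_Icc a t) hs' hs

theorem exists_symbolSeminorm_heat_le (t : ℝ) (i N : ℕ) : ∃ D : ℝ≥0∞, D ≠ ⊤ ∧
    ∀ s ∈ Set.Icc 0 t, symbolSeminorm (i + 2) N (heat s i) ≤ D ∧
      ∀ s' ∈ Set.Icc 0 t,
        symbolSeminorm (i + 2) N (heat s i - heat s' i) ≤ D * edist s s' := by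
  choose B₁ hB₁ h₁ using fun k => exists_norm_dHeat_le_zpow t k i 0
  choose B₂ hB₂ h₂ using fun k => exists_norm_dHeat_le_zpow t k (i + 2) 0
  simp only [pow_zero, one_mul, Nat.cast_zero, mul_zero, sub_zero] at h₁ h₂
  set B : ℕ → ℝ := fun k => B₁ k + B₂ k with hB
  have h₁' : ∀ k, ∀ s ∈ Set.Icc 0 t, ∀ x : ℝ,
      ‖dHeat k s i x‖ ≤ B k * (1 + |x|) ^ (((i + 2 : ℕ) : ℤ) - k) := fun k s hs x => by
    refine (h₁ k s hs x).trans ?_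
    have := hB₁ k
    have := hB₂ k
    gcongr
    · rw [hB]; simp only; linarith
    · linarith [abs_nonneg x]
    · omega
  have h₂' : ∀ k, ∀ s ∈ Set.Icc 0 t, ∀ x : ℝ,
      ‖dHeat k s (i + 2) x‖ ≤ B k * (1 + |x|) ^ (((i + 2 : ℕ) : ℤ) - k) := fun k s hs x => by
    refine (h₂ k s hs x).trans ?_
    have := hB₁ k
    gcongr
    rw [hB]; simp only; linarith
  refine ⟨∑ k ∈ Finset.range (N + 1), ENNReal.ofReal (B k),
    ENNReal.sum_ne_top.2 fun _ _ => ENNReal.ofReal_ne_top, fun s hs =>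
    ⟨?_, fun s' hs' => ?_⟩⟩
  · have := symbolSeminorm_le (m := i + 2) (N := N) (f := heat s i) (B := B) zero_le_one
      fun k x => by rw [iteratedDeriv_heat, one_mul]; exact h₁' k s hs x
    simpa using this
  · rw [mul_comm, edist_dist, Real.dist_eq]
    exact symbolSeminorm_le (abs_nonneg _) fun k x =>
      norm_iteratedDeriv_heat_sub_le (fun s hs => h₂' k s hs x) hs hs'

theorem exists_decaySeminorm_heat_le {s₀ : ℝ} (hs₀ : 0 < s₀) (t : ℝ) {m : ℕ}
    (hm : 1 / (m : ℝ) ≤ s₀) (i N : ℕ) : ∃ D : ℝ≥0∞, D ≠ ⊤ ∧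
    ∀ s ∈ Set.Icc s₀ t, decaySeminorm m N (heat s i) ≤ D ∧
      ∀ s' ∈ Set.Icc s₀ t, decaySeminorm m N (heat s i - heat s' i) ≤ D * edist s s' := by
  choose B₁ hB₁ h₁ using fun k => exists_norm_dHeat_le_exp t k i
  choose B₂ hB₂ h₂ using fun k => exists_norm_dHeat_le_exp t k (i + 2)
  set w : ℕ → ℝ → ℝ := fun k x =>
    (B₁ k + B₂ k) * (1 + |x|) ^ (i + 2 + k) * Real.exp (-(s₀ * x ^ 2)) with hw
  have hI : ∀ s ∈ Set.Icc s₀ t, s ∈ Set.Icc 0 t := fun s hs => ⟨hs₀.le.trans hs.1, hs.2⟩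
  have h₁' : ∀ k, ∀ s ∈ Set.Icc s₀ t, ∀ x : ℝ, ‖dHeat k s i x‖ ≤ w k x := fun k s hs x => by
    refine (h₁ k s (hI s hs) x).trans ?_
    have := hB₁ k
    have := hB₂ k
    have := hs.1
    simp only [hw]
    gcongr
    · linarith
    · linarith [abs_nonneg x]
    · omega
  have h₂' : ∀ k, ∀ s ∈ Set.Icc s₀ t, ∀ x : ℝ, ‖dHeat k s (i + 2) x‖ ≤ w k x :=
    fun k s hs x => by
    refine (h₂ k s (hI s hs) x).trans ?_
    have := hB₁ k
    have := hB₂ k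
    have := hs.1
    simp only [hw]
    gcongr
    linarith
  refine ⟨∑ k ∈ Finset.range (N + 1), (∫⁻ x : ℝ, ENNReal.ofReal (Real.exp (1 / (m : ℝ) * x ^ 2)) *
    ENNReal.ofReal (w k x) ^ 2) ^ (1 / 2 : ℝ), ?_, fun s hs => ⟨?_, fun s' hs' => ?_⟩⟩
  · refine ENNReal.sum_ne_top.2 fun k _ => ENNReal.rpow_ne_top_of_nonneg (by norm_num) ?_
    exact (lintegral_decay_lt_top hs₀ hm (add_nonneg (hB₁ k) (hB₂ k)) _).ne
  · have := decaySeminorm_le (m := m) (N := N) (f := heat s i) (w := w) zero_le_one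
      fun k x => by rw [iteratedDeriv_heat, one_mul]; exact h₁' k s hs x
    simpa using this
  · rw [mul_comm, edist_dist, Real.dist_eq]
    exact decaySeminorm_le (abs_nonneg _) fun k x =>
      norm_iteratedDeriv_heat_sub_le (fun s hs => h₂' k s hs x) hs hs'

/-! ### Integrals of elementary tensors in the completed tensor products -/

theorem projSeminorm_tensor_le {n : ℕ} {k : Fin (n + 1)} {m : Fin (n + 1) → ℕ} (N : ℕ)
    {a : Fin (n + 1) → ℝ → ℂ} (ha : ∀ j, a j ∈ slotSpace k m j) :
    projSeminorm k m N (tensor a) ≤ ∏ j, slotSeminorm k m N j (a j) :=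
  iInf_le_of_le [a] (iInf_le_of_le (by simpa using ha) (iInf_le_of_le (by simp) (by simp)))

theorem projSeminorm_sum_le {ι : Type*} {n : ℕ} (k : Fin (n + 1)) (m : Fin (n + 1) → ℕ) (N : ℕ)
    (s : Finset ι) (g : ι → Fun n) :
    projSeminorm k m N (∑ i ∈ s, g i) ≤ ∑ i ∈ s, projSeminorm k m N (g i) := by
  classical
  induction s using Finset.induction_on with
  | empty => simp [projSeminorm_zero]
  | insert i s hi ih =>
    rw [Finset.sum_insert hi, Finset.sum_insert hi]
    exact (projSeminorm_add_le _ _ _ _ _).trans (by gcongr)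

/-- The difference of two elementary tensors, one factor being replaced at a time. -/
theorem tensor_sub_tensor {n : ℕ} (a a' : Fin n → ℝ → ℂ) :
    tensor a - tensor a' = ∑ i, tensor fun j =>
      if j < i then a' j else if j = i then a j - a' j else a j := by
  funext x
  have h := Finset.prod_sub_ordered Finset.univ (fun j => a j (x j)) fun j => a j (x j) - a' j (x j)
  simp only [sub_sub_cancel] at h
  rw [Pi.sub_apply, Finset.sum_apply]
  simp only [tensor]
  rw [h, sub_sub_cancel]
  refine Finset.sum_congr rfl fun i _ => ?_
  have e : ∀ j, (if j < i then a' j else if j = i then a j - a' j else a j) (x j) =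
      if j < i then a' j (x j) else if j = i then a j (x j) - a' j (x j) else a j (x j) := by
    intro j
    split_ifs <;> rfl
  simp only [e]
  rw [Finset.prod_ite, mul_assoc, mul_left_comm]
  congr 1
  have h1 : Finset.univ.filter (fun j => ¬ j < i) = insert i (Finset.univ.filter (i < ·)) := by
    ext j; simp [le_iff_eq_or_lt, eq_comm]
  rw [h1, Finset.prod_insert (by simp), if_pos rfl]
  congr 1
  refine Finset.prod_congr rfl fun j hj => ?_
  rw [if_neg (Finset.mem_filter.1 hj).2.ne']

theorem projSeminorm_tensor_sub_le {n : ℕ} {k : Fin (n + 1)} {m : Fin (n + 1) → ℕ} {N : ℕ}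
    {a a' : Fin (n + 1) → ℝ → ℂ} (ha : ∀ j, a j ∈ slotSpace k m j)
    (ha' : ∀ j, a' j ∈ slotSpace k m j) (hs : ∀ j, a j - a' j ∈ slotSpace k m j) {D E : ℝ≥0∞}
    (hD : ∀ j, slotSeminorm k m N j (a j) ≤ D) (hD' : ∀ j, slotSeminorm k m N j (a' j) ≤ D)
    (hE : ∀ j, slotSeminorm k m N j (a j - a' j) ≤ E) :
    projSeminorm k m N (tensor a - tensor a') ≤ (n + 1) * (E * D ^ n) := by
  rw [tensor_sub_tensor]
  refine (projSeminorm_sum_le _ _ _ _ _).trans ?_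
  have h : ∀ i : Fin (n + 1), projSeminorm k m N (tensor fun j =>
      if j < i then a' j else if j = i then a j - a' j else a j) ≤ E * D ^ n := by
    intro i
    refine (projSeminorm_tensor_le N fun j => ?_).trans ?_
    · split_ifs
      exacts [ha' j, hs j, ha j]
    · rw [← Finset.mul_prod_erase Finset.univ _ (Finset.mem_univ i)]
      have hc : (Finset.univ.erase i).card = n := by simp
      refine mul_le_mul' ?_ ?_
      · simpa using hE i
      · refine (Finset.prod_le_pow_card _ _ D fun j hj => ?_).trans (by rw [hc])
        split_ifs with h1 h2
        exacts [hD' j, absurd h2 (Finset.ne_of_mem_erase hj), hD j]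
  refine (Finset.sum_le_sum fun i _ => h i).trans (le_of_eq ?_)
  simp

theorem integral_comp_simpleFunc {X Y : Type*} [MeasurableSpace X] {ν : Measure X}
    [IsFiniteMeasure ν] (φ : SimpleFunc X Y) (W : Y → ℂ) :
    ∫ s, W (φ s) ∂ν = ∑ y ∈ φ.range, ((ν (φ ⁻¹' {y})).toReal : ℂ) * W y := by
  classical
  have e : ∀ s, W (φ s) = ∑ y ∈ φ.range, (φ ⁻¹' {y}).indicator (fun _ => W y) s := by
    intro s
    rw [Finset.sum_eq_single_of_mem (φ s) (SimpleFunc.mem_range_self φ s)]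
    · rw [Set.indicator_of_mem (show s ∈ φ ⁻¹' {φ s} from rfl)]
    · intro y _ hy
      exact Set.indicator_of_notMem (fun h => hy h.symm) _
  simp only [e]
  rw [integral_finsetSum _ fun y _ =>
    (integrable_const (W y)).indicator (φ.measurableSet_fiber y)]
  refine Finset.sum_congr rfl fun y _ => ?_
  rw [integral_indicator_const _ (φ.measurableSet_fiber y), Complex.real_smul]
  rfl

/-- A compact set has finite measurable partitions into small pieces; the value of the
simple function is a point that represents its piece. -/
theorem exists_simpleFunc_edist_le {X : Type*} [PseudoMetricSpace X] [MeasurableSpace X]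
    [OpensMeasurableSpace X] {K : Set X} (hK : IsCompact K) (hne : K.Nonempty) {ε : ℝ}
    (hε : 0 < ε) :
    ∃ φ : SimpleFunc X X, (∀ s, φ s ∈ K) ∧ ∀ s ∈ K, edist (φ s) s ≤ ENNReal.ofReal ε := by
  obtain ⟨T, hTK, hTf, hT⟩ := finite_cover_balls_of_compact hK hε
  have hTne : T.Nonempty := by
    obtain ⟨s, hs⟩ := hne
    obtain ⟨y, hy, -⟩ := Set.mem_iUnion₂.1 (hT hs)
    exact ⟨y, hy⟩
  obtain ⟨e, rfl⟩ := hTf.countable.exists_eq_range hTne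
  choose! idx hidx using fun y : X => fun hy : y ∈ Set.range e => hy
  obtain ⟨N, hN⟩ := (hTf.image idx).bddAbove
  refine ⟨SimpleFunc.nearestPt e N, fun s => hTK ⟨_, rfl⟩, fun s hs => ?_⟩
  obtain ⟨y, hy, hys⟩ := Set.mem_iUnion₂.1 (hT hs)
  refine (SimpleFunc.edist_nearestPt_le e s (hN ⟨y, hy, rfl⟩)).trans ?_
  rw [hidx y hy, edist_comm, edist_dist]
  exact ENNReal.ofReal_le_ofReal (Metric.mem_ball.1 hys).le

/-- An integral over a compact set of elementary tensors lies in the completed tensor product if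
the factors are Lipschitz functions of the parameter with respect to all seminorms: it is the limit
of its Riemann sums. -/
theorem integral_tensor_mem_completedTensor {n : ℕ} (k : Fin (n + 1)) (m : Fin (n + 1) → ℕ)
    (ν : Measure (Fin (n + 1) → ℝ)) [IsFiniteMeasure ν] {K : Set (Fin (n + 1) → ℝ)}
    (hK : IsCompact K) (hν : ∀ᵐ s ∂ν, s ∈ K) (u : Fin (n + 1) → ℝ → ℝ → ℂ)
    (hu : ∀ j s, ContDiff ℝ ∞ (u j s)) (hc : ∀ j x, Continuous fun s => u j s x)
    (hD : ∀ N j, ∃ D : ℝ≥0∞, D ≠ ⊤ ∧ ∀ s ∈ K, slotSeminorm k m N j (u j (s j)) ≤ D ∧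
      ∀ s' ∈ K, slotSeminorm k m N j (u j (s j) - u j (s' j)) ≤ D * edist (s j) (s' j)) :
    (fun x => ∫ s, tensor (fun j => u j (s j)) x ∂ν) ∈ completedTensor k m := by
  rcases K.eq_empty_or_nonempty with rfl | hne
  · have : ν = 0 := by
      have : ν Set.univ = 0 := by simpa [ae_iff] using hν
      exact Measure.measure_univ_eq_zero.1 this
    simp only [this, integral_zero_measure]
    exact Submodule.zero_mem _
  -- Uniform constants for all factors.
  have hD' : ∀ N, ∃ D : ℝ≥0∞, D ≠ ⊤ ∧ ∀ j, ∀ s ∈ K, slotSeminorm k m N j (u j (s j)) ≤ D ∧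
      ∀ s' ∈ K, slotSeminorm k m N j (u j (s j) - u j (s' j)) ≤ D * edist s s' := by
    intro N
    choose D hDt hDb using hD N
    refine ⟨∑ j, D j, ENNReal.sum_ne_top.2 fun j _ => hDt j, fun j s hs => ⟨?_, fun s' hs' => ?_⟩⟩
    · exact ((hDb j s hs).1).trans (Finset.single_le_sum_of_canonicallyOrdered (Finset.mem_univ j))
    · refine ((hDb j s hs).2 s' hs').trans (mul_le_mul' ?_ (edist_le_pi_edist s s' j))
      exact Finset.single_le_sum_of_canonicallyOrdered (Finset.mem_univ j)
  have hmem : ∀ s ∈ K, ∀ j, u j (s j) ∈ slotSpace k m j := by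
    refine fun s hs j => ⟨hu j _, fun N => ?_⟩
    obtain ⟨D, hDt, hDb⟩ := hD' N
    exact (hDb j s hs).1.trans_lt hDt.lt_top
  have hmem' : ∀ s ∈ K, ∀ s' ∈ K, ∀ j, u j (s j) - u j (s' j) ∈ slotSpace k m j := by
    refine fun s hs s' hs' j => ⟨(hu j _).sub (hu j _), fun N => ?_⟩
    obtain ⟨D, hDt, hDb⟩ := hD' N
    exact ((hDb j s hs).2 s' hs').trans_lt (ENNReal.mul_lt_top hDt.lt_top (edist_lt_top _ _))
  set T : (Fin (n + 1) → ℝ) → Fun n := fun s => tensor fun j => u j (s j) with hT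
  have hTc : ∀ x, Continuous fun s => T s x := fun x =>
    continuous_finsetProd _ fun j _ => (hc j (x j)).comp (continuous_apply j)
  choose φ hφK hφ using fun i : ℕ =>
    exists_simpleFunc_edist_le hK hne (ε := 1 / ((i : ℝ) + 1)) (by positivity)
  have hε : Tendsto (fun i : ℕ => ENNReal.ofReal (1 / ((i : ℝ) + 1))) atTop (𝓝 0) := by
    have := ENNReal.tendsto_ofReal tendsto_one_div_add_atTop_nhds_zero_nat
    simpa using this
  have hgx : ∀ i x, (∑ y ∈ (φ i).range, ((ν (φ i ⁻¹' {y})).toReal : ℂ) • T y) x =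
      ∫ s, T (φ i s) x ∂ν := by
    intro i x
    rw [integral_comp_simpleFunc (φ i) fun y => T y x, Finset.sum_apply]
    rfl
  refine ⟨fun i => ∑ y ∈ (φ i).range, ((ν (φ i ⁻¹' {y})).toReal : ℂ) • T y, fun i => ?_,
    fun N => ?_, fun x => ?_⟩
  · refine Submodule.sum_mem _ fun y hy => Submodule.smul_mem _ _ (Submodule.subset_span ?_)
    obtain ⟨s, rfl⟩ := SimpleFunc.mem_range.1 hy
    exact ⟨_, hmem _ (hφK i s), rfl⟩
  · obtain ⟨D, hDt, hDb⟩ := hD' N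
    set M : ℝ≥0∞ := ν Set.univ * ((n + 1) * D ^ (n + 1)) with hM
    have hMt : M ≠ ⊤ := by
      refine ENNReal.mul_ne_top (measure_ne_top _ _) (ENNReal.mul_ne_top (by finiteness) ?_)
      exact ENNReal.pow_ne_top hDt
    -- On the common refinement of two partitions the factors differ by a small amount.
    have key : ∀ p q : ℕ, projSeminorm k m N
        ((∑ y ∈ (φ p).range, ((ν (φ p ⁻¹' {y})).toReal : ℂ) • T y) -
          ∑ y ∈ (φ q).range, ((ν (φ q ⁻¹' {y})).toReal : ℂ) • T y) ≤
        M * (ENNReal.ofReal (1 / ((p : ℝ) + 1)) + ENNReal.ofReal (1 / ((q : ℝ) + 1))) := by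
      intro p q
      set Φ := (φ p).pair (φ q) with hΦ
      set δ := ENNReal.ofReal (1 / ((p : ℝ) + 1)) + ENNReal.ofReal (1 / ((q : ℝ) + 1)) with hδ
      have e : (∑ y ∈ (φ p).range, ((ν (φ p ⁻¹' {y})).toReal : ℂ) • T y) -
          ∑ y ∈ (φ q).range, ((ν (φ q ⁻¹' {y})).toReal : ℂ) • T y =
          ∑ y ∈ Φ.range, ((ν (Φ ⁻¹' {y})).toReal : ℂ) • (T y.1 - T y.2) := by
        funext x
        have hint : ∀ i, Integrable (fun s => T (φ i s) x) ν := fun i =>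
          SimpleFunc.integrable_of_isFiniteMeasure ((φ i).map fun y => T y x)
        rw [Pi.sub_apply, hgx, hgx, ← integral_sub (hint p) (hint q), Finset.sum_apply]
        exact integral_comp_simpleFunc Φ fun y => T y.1 x - T y.2 x
      rw [e]
      refine (projSeminorm_sum_le _ _ _ _ _).trans ?_
      have hterm : ∀ y ∈ Φ.range, projSeminorm k m N
          (((ν (Φ ⁻¹' {y})).toReal : ℂ) • (T y.1 - T y.2)) ≤
          ν (Φ ⁻¹' {y}) * ((n + 1) * (D * δ * D ^ n)) := by
        intro y _
        have hen : ‖((ν (Φ ⁻¹' {y})).toReal : ℂ)‖ₑ = ν (Φ ⁻¹' {y}) := by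
          rw [← ofReal_norm, Complex.norm_real, Real.norm_of_nonneg ENNReal.toReal_nonneg,
            ENNReal.ofReal_toReal (measure_ne_top _ _)]
        refine (projSeminorm_smul_le _ _ _ _ _).trans ?_
        rw [hen]
        by_cases hy : ∃ s ∈ K, Φ s = y
        · obtain ⟨s, hs, rfl⟩ := hy
          gcongr
          have hd : edist (φ p s) (φ q s) ≤ δ := by
            refine (edist_triangle_right _ _ s).trans ?_
            exact add_le_add (hφ p s hs) (hφ q s hs)
          have h1 := hφK p s
          have h2 := hφK q s
          exact projSeminorm_tensor_sub_le (hmem _ h1) (hmem _ h2) (hmem' _ h1 _ h2)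
            (fun j => (hDb j _ h1).1) (fun j => (hDb j _ h2).1)
            fun j => ((hDb j _ h1).2 _ h2).trans (by gcongr)
        · have h0 : ν (Φ ⁻¹' {y}) = 0 := by
            refine measure_mono_null (t := Kᶜ) (fun s hs hsK => hy ⟨s, hsK, hs⟩) ?_
            exact ae_iff.1 hν
          rw [h0, zero_mul, zero_mul]
      refine (Finset.sum_le_sum hterm).trans (le_of_eq ?_)
      rw [← Finset.sum_mul, SimpleFunc.sum_range_measure_preimage_singleton, hM]
      ring
    have hlim : Tendsto (fun p : ℕ × ℕ => M * (ENNReal.ofReal (1 / ((p.1 : ℝ) + 1)) +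
        ENNReal.ofReal (1 / ((p.2 : ℝ) + 1)))) atTop (𝓝 0) := by
      rw [← prod_atTop_atTop_eq]
      have := (hε.comp tendsto_fst).add (hε.comp (tendsto_snd (f := atTop (α := ℕ))))
      have h2 := ENNReal.Tendsto.const_mul (a := M) this (Or.inr hMt)
      simpa using h2
    exact tendsto_of_tendsto_of_tendsto_of_le_of_le tendsto_const_nhds hlim (fun _ => bot_le)
      fun p => key p.1 p.2
  · simp only [hgx]
    obtain ⟨B, hB⟩ := hK.exists_bound_of_continuousOn (hTc x).continuousOn
    refine tendsto_integral_of_dominated_convergence (fun _ => B)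
      (fun i => ((φ i).map fun y => T y x).aestronglyMeasurable) (integrable_const B)
      (fun i => ae_of_all _ fun s => hB _ (hφK i s)) ?_
    filter_upwards [hν] with s hs
    refine ((hTc x).tendsto s).comp ?_
    rw [tendsto_iff_edist_tendsto_0]
    exact tendsto_of_tendsto_of_tendsto_of_le_of_le tendsto_const_nhds hε (fun _ => bot_le)
      fun i => hφ i s hs

/-! ### Heat chains belong to `𝓕^(n)` -/

/-- The simplex of all `(t_0, ..., t_n)` with `t_p ≥ 0` and `t_0 + ... + t_n = t`. -/
def fullSimplex (n : ℕ) (t : ℝ) : Set (Fin (n + 1) → ℝ) := {s | (∀ p, 0 ≤ s p) ∧ ∑ p, s p = t}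

theorem isCompact_fullSimplex (n : ℕ) (t : ℝ) : IsCompact (fullSimplex n t) := by
  have e : fullSimplex n t = solidSimplex (n + 1) t ∩ {s | ∑ p, s p = t} := by
    ext s
    simp only [fullSimplex, solidSimplex, Set.mem_inter_iff, Set.mem_ofPred_eq]
    constructor
    · rintro ⟨h, h'⟩; exact ⟨⟨h, h'.le⟩, h'⟩
    · rintro ⟨⟨h, -⟩, h'⟩; exact ⟨h, h'⟩
  rw [e]
  exact (isCompact_solidSimplex _ _).inter_right (isClosed_eq (by fun_prop) continuous_const)

theorem le_of_mem_fullSimplex {n : ℕ} {t : ℝ} {s : Fin (n + 1) → ℝ} (hs : s ∈ fullSimplex n t)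
    (p : Fin (n + 1)) : s p ≤ t := by
  rw [← hs.2]
  exact Finset.single_le_sum (fun i _ => hs.1 i) (Finset.mem_univ p)

/-- The integral of `⊗_p e^{-s_p x²} x^{e_p}` over `s` with respect to a measure `ν`. -/
def heatChain {n : ℕ} (ν : Measure (Fin (n + 1) → ℝ)) (e : Fin (n + 1) → ℕ) : Fun n := fun x =>
  ∫ s, tensor (fun p => heat (s p) (e p)) x ∂ν

theorem integrable_tensor_heat {n : ℕ} {t : ℝ} {ν : Measure (Fin (n + 1) → ℝ)}
    [IsFiniteMeasure ν] (hν : ∀ᵐ s ∂ν, s ∈ fullSimplex n t) (e : Fin (n + 1) → ℕ)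
    (x : Fin (n + 1) → ℝ) : Integrable (fun s => tensor (fun p => heat (s p) (e p)) x) ν := by
  have h : IntegrableOn (fun s => tensor (fun p => heat (s p) (e p)) x) (fullSimplex n t) ν :=
    (continuous_tensor_heat e x).continuousOn.integrableOn_compact (isCompact_fullSimplex n t)
  rwa [IntegrableOn, Measure.restrict_eq_self_of_ae_mem hν] at h

theorem mem_F_of_mem_completedTensor {n : ℕ} {k : Fin (n + 1)} {m : Fin (n + 1) → ℕ}
    (hm : 0 < m k) {f : Fun n} (hf : f ∈ completedTensor k m) : f ∈ F n := by
  unfold F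
  exact Submodule.mem_iSup_of_mem k (Submodule.mem_iSup_of_mem m
    (Submodule.mem_iSup_of_mem hm hf))

/-- Where `t_k` is bounded below, the factor number `k` decays like a Gaussian. -/
theorem heatChain_mem_F_of_ae_le {n : ℕ} {t s₀ : ℝ} (hs₀ : 0 < s₀)
    {ν : Measure (Fin (n + 1) → ℝ)} [IsFiniteMeasure ν] (k : Fin (n + 1))
    (hν : ∀ᵐ s ∂ν, s ∈ fullSimplex n t ∩ {s | s₀ ≤ s k}) (e : Fin (n + 1) → ℕ) :
    heatChain ν e ∈ F n := by
  obtain ⟨M, hM⟩ := exists_nat_one_div_lt hs₀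
  set m : Fin (n + 1) → ℕ := fun j => if j = k then M + 1 else e j + 2 with hm
  refine mem_F_of_mem_completedTensor (k := k) (m := m) (by simp [hm])
    (integral_tensor_mem_completedTensor k m ν (K := fullSimplex n t ∩ {s | s₀ ≤ s k})
      ((isCompact_fullSimplex n t).inter_right
        (isClosed_le continuous_const (continuous_apply k))) hν (fun j s => heat s (e j))
      (fun j s => contDiff_heat s (e j)) (fun j x => continuous_heat (e j) x) fun N j => ?_)
  by_cases hj : j = k
  · subst hj
    obtain ⟨D, hDt, hD⟩ := exists_decaySeminorm_heat_le hs₀ t (m := m j)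
      (by simpa [hm] using hM.le) (e j) N
    refine ⟨D, hDt, fun s hs => ?_⟩
    simp only [slotSeminorm, if_true]
    have h := hD (s j) ⟨hs.2, le_of_mem_fullSimplex hs.1 j⟩
    exact ⟨h.1, fun s' hs' => h.2 _ ⟨hs'.2, le_of_mem_fullSimplex hs'.1 j⟩⟩
  · obtain ⟨D, hDt, hD⟩ := exists_symbolSeminorm_heat_le t (e j) N
    refine ⟨D, hDt, fun s hs => ?_⟩
    simp only [slotSeminorm, if_neg hj, hm]
    have h := hD (s j) ⟨hs.1.1 j, le_of_mem_fullSimplex hs.1 j⟩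
    exact ⟨h.1, fun s' hs' => h.2 _ ⟨hs'.1.1 j, le_of_mem_fullSimplex hs'.1 j⟩⟩

theorem heatChain_mem_F {n : ℕ} {t : ℝ} (ht : 0 < t) {ν : Measure (Fin (n + 1) → ℝ)}
    [IsFiniteMeasure ν] (hν : ∀ᵐ s ∂ν, s ∈ fullSimplex n t) (e : Fin (n + 1) → ℕ) :
    heatChain ν e ∈ F n := by
  classical
  set s₀ : ℝ := t / (n + 1) with hs₀
  have hpos : 0 < s₀ := by positivity
  -- The simplex is cut into pieces on which one coordinate is at least the mean value.
  have key : ∀ (J : Finset (Fin (n + 1))) (ν : Measure (Fin (n + 1) → ℝ)) [IsFiniteMeasure ν],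
      (∀ᵐ s ∂ν, s ∈ fullSimplex n t ∧ ∃ k ∈ J, s₀ ≤ s k) → heatChain ν e ∈ F n := by
    intro J
    induction J using Finset.induction_on with
    | empty =>
      intro ν _ h
      have h0 : ν = 0 := by
        rw [← ae_eq_bot, ← eventually_false_iff_eq_bot]
        exact h.mono fun s hs => by simpa using hs.2
      have : heatChain ν e = 0 := by
        funext x; simp [heatChain, h0]
      rw [this]; exact Submodule.zero_mem _
    | insert k J _ ih =>
      intro ν _ h
      have hms : MeasurableSet {s : Fin (n + 1) → ℝ | s₀ ≤ s k} :=
        measurableSet_le measurable_const (measurable_pi_apply k)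
      have hν : ∀ᵐ s ∂ν, s ∈ fullSimplex n t := h.mono fun s hs => hs.1
      have e1 : heatChain ν e = heatChain (ν.restrict {s | s₀ ≤ s k}) e +
          heatChain (ν.restrict {s | s₀ ≤ s k}ᶜ) e := by
        funext x
        exact (integral_add_compl hms (integrable_tensor_heat hν e x)).symm
      rw [e1]
      refine Submodule.add_mem _ (heatChain_mem_F_of_ae_le (t := t) hpos k ?_ e) (ih _ ?_)
      · filter_upwards [ae_restrict_of_ae hν, ae_restrict_mem hms] with s h1 h2
        exact ⟨h1, h2⟩
      · filter_upwards [ae_restrict_of_ae h, ae_restrict_mem hms.compl] with s h1 h2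
        refine ⟨h1.1, ?_⟩
        obtain ⟨j, hj, hjs⟩ := h1.2
        rcases Finset.mem_insert.1 hj with rfl | hj
        · exact absurd hjs h2
        · exact ⟨j, hj, hjs⟩
  refine key Finset.univ ν (hν.mono fun s hs => ⟨hs, ?_⟩)
  by_contra! hlt
  have h1 : ∑ p, s p < ∑ _p : Fin (n + 1), s₀ :=
    Finset.sum_lt_sum_of_nonempty Finset.univ_nonempty fun p hp => hlt p hp
  rw [hs.2, Fin.sum_const, nsmul_eq_mul, hs₀] at h1
  push_cast at h1
  rw [mul_div_cancel₀ _ (by positivity)] at h1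
  exact lt_irrefl _ h1

theorem hasDegree_heat (s : ℝ) (i : ℕ) : HasDegree (heat s i) i := by
  intro x
  simp only [heat]
  rw [neg_sq, neg_pow x]
  push_cast
  ring

/-- The span of the heat chains of the measures on the simplex of size `t`. -/
def heatChains (n : ℕ) (t : ℝ) : Submodule ℂ (Fun n) :=
  Submodule.span ℂ {f | ∃ ν : Measure (Fin (n + 1) → ℝ), IsFiniteMeasure ν ∧
    (∀ᵐ s ∂ν, s ∈ fullSimplex n t) ∧ ∃ e, f = heatChain ν e}

theorem heatChains_le_F (n : ℕ) {t : ℝ} (ht : 0 < t) : heatChains n t ≤ F n := by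
  refine Submodule.span_le.2 ?_
  rintro f ⟨ν, hfin, hν, e, rfl⟩
  exact heatChain_mem_F ht hν e

/-- The cyclic operator rotates the simplex. -/
theorem cyc_mem_heatChains {n : ℕ} {t : ℝ} {f : Fun n} (hf : f ∈ heatChains n t) :
    cyc n f ∈ heatChains n t := by
  have hle : heatChains n t ≤ (heatChains n t).comap (cyc n) := by
    refine Submodule.span_le.2 ?_
    rintro f ⟨ν, hfin, hν, e, rfl⟩
    set ρ : (Fin (n + 1) → ℝ) → Fin (n + 1) → ℝ := fun s => Fin.cons (s (Fin.last n)) (Fin.init s)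
      with hρ
    set e' : Fin (n + 1) → ℕ := Fin.cons (e (Fin.last n)) (Fin.init e) with he'
    have hρc : Continuous ρ := by
      refine continuous_pi fun j => ?_
      refine Fin.cases ?_ (fun i => ?_) j
      · simpa [hρ] using continuous_apply (Fin.last n)
      · simpa [hρ, Fin.init] using continuous_apply i.castSucc
    have hρν : ∀ᵐ s ∂(ν.map ρ), s ∈ fullSimplex n t := by
      refine (ae_map_iff hρc.aemeasurable (p := (· ∈ fullSimplex n t))
        (isCompact_fullSimplex n t).measurableSet).2 ?_
      refine hν.mono fun s hs => ⟨fun p => ?_, ?_⟩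
      · refine Fin.cases ?_ (fun i => ?_) p
        · exact hs.1 _
        · exact hs.1 _
      · rw [← hs.2, Fin.sum_univ_succ, Fin.sum_univ_castSucc s, add_comm]
        simp [hρ, Fin.init]
    have hI := integrable_tensor_heat hν e
    have h1 : cyc n (heatChain ν e) =
        (-1 : ℂ) ^ (n + e (Fin.last n) * ∑ j : Fin n, e j.castSucc) •
          heatChain (ν.map ρ) e' := by
      funext x
      have h2 : cyc n (heatChain ν e) x =
          ∫ s, cyc n (tensor fun p => heat (s p) (e p)) x ∂ν := by
        simp only [cyc, LinearMap.coe_mk, AddHom.coe_mk, koszul, heatChain]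
        rw [integral_const_mul, integral_add, integral_div, integral_div,
          integral_add (hI _) (hI _),
          integral_sub (hI _) (hI _)]
        · exact ((hI _).add (hI _)).div_const _
        · exact ((hI _).sub (hI _)).div_const _
      rw [h2, Pi.smul_apply, heatChain,
        integral_map hρc.aemeasurable (continuous_tensor_heat e' x).aestronglyMeasurable,
        smul_eq_mul, ← integral_const_mul]
      congr 1
      funext s
      rw [cyc_tensor _ e fun j => hasDegree_heat _ _, Pi.smul_apply, smul_eq_mul]
      congr 2
      funext p
      refine Fin.cases ?_ (fun i => ?_) p
      · rfl
      · rfl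
    rw [SetLike.mem_coe, Submodule.mem_comap, h1]
    exact Submodule.smul_mem _ _ (Submodule.subset_span ⟨_, inferInstance, hρν, e', rfl⟩)
  exact hle hf

theorem heatIntegral_mem_heatChains (n : ℕ) (K : Finset ℕ) (e : ℕ → ℕ) (t : ℝ) :
    heatIntegral n K e t ∈ heatChains n t := by
  set μ : Measure (Fin n → ℝ) :=
    (Measure.pi fun p : Fin n => slotMeasure K p).restrict (solidSimplex n t) with hμ
  have hfin : IsFiniteMeasure μ := ⟨by
    rw [hμ, Measure.restrict_apply_univ]
    exact (isCompact_solidSimplex n t).measure_lt_top⟩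
  have hc := continuous_snoc_sub_sum n t
  refine Submodule.subset_span ⟨μ.map fun s => Fin.snoc s (t - ∑ p, s p), inferInstance, ?_,
    fun p => e p, ?_⟩
  · refine (ae_map_iff hc.aemeasurable (p := (· ∈ fullSimplex n t))
      (isCompact_fullSimplex n t).measurableSet).2 ?_
    refine (ae_restrict_mem (isCompact_solidSimplex n t).measurableSet).mono fun s hs =>
      ⟨fun p => ?_, ?_⟩
    · refine Fin.lastCases ?_ (fun i => ?_) p
      · rw [Fin.snoc_last]; exact sub_nonneg.2 hs.2
      · rw [Fin.snoc_castSucc]; exact hs.1 i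
    · rw [Fin.sum_univ_castSucc]
      simp
  · funext x
    rw [heatChain, integral_map hc.aemeasurable
      (continuous_tensor_heat (fun p : Fin (n + 1) => e p) x).aestronglyMeasurable]
    rfl

theorem psi_mem_heatChains (n : ℕ) (t : ℝ) : psi n t ∈ heatChains n t := by
  refine Submodule.sum_mem _ fun c _ => ?_
  have : chi n c.1 c.2 t = (-1 : ℂ) ^ deg n c.1 c.2 • heatIntegral n c.1 (expo c.1 c.2) t := rfl
  rw [this]
  exact Submodule.smul_mem _ _ (heatIntegral_mem_heatChains n _ _ t)

theorem psiTilde_mem_heatChains (n : ℕ) (t : ℝ) : psiTilde n t ∈ heatChains n t := by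
  rcases n with _ | n
  · exact Submodule.zero_mem _
  refine Submodule.sum_mem _ fun c _ => ?_
  have : chiTilde n c.1 c.2 t = (-1 : ℂ) ^ deg n c.1 c.2 • heatIntegral (n + 1)
      (consShift 1 c.1) (fun p => if p = 0 then 0 else expo c.1 c.2 (p - 1)) t :=
    funext fun x => chiTilde_eq n c.1 c.2 t x
  rw [this]
  exact Submodule.smul_mem _ _ (heatIntegral_mem_heatChains (n + 1) _ _ t)

theorem psiTilde_zero (n : ℕ) : psiTilde n 0 = 0 := by
  rcases n with _ | n
  · rfl
  · funext x
    rw [psiTilde_succ_apply n le_rfl, intervalIntegral.integral_same, Pi.zero_apply]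

theorem psiTilde_mem_oneSubCyc (n : ℕ) {t : ℝ} (ht : 0 ≤ t) : psiTilde n t ∈ oneSubCyc n := by
  rcases n with _ | n
  · exact Submodule.zero_mem _
  rcases ht.eq_or_lt with rfl | ht'
  -- At `t = 0` the factors have no Gaussian decay, but the simplex has volume zero.
  · rw [psiTilde_zero]; exact Submodule.zero_mem _
  refine mem_map_one_sub_of_sum_pow_eq_zero (cyc (n + 1)) (F (n + 1)) (n + 1) (fun i => ?_)
    (sum_cyc_pow_psiTilde n ht)
  refine heatChains_le_F (n + 1) ht' ?_
  induction i with
  | zero => exact psiTilde_mem_heatChains (n + 1) t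
  | succ i ih =>
    rw [pow_succ']
    exact cyc_mem_heatChains ih

end CyclicHeat

end

theorem mainTheorem2 :
    (∀ (n : ℕ) (t : ℝ), 0 < t → CyclicHeat.IsCyclicCycle n (CyclicHeat.psi n t)) ∧
    (∀ (n : ℕ) (t : ℝ), 0 ≤ t →
      CyclicHeat.hochschild n (CyclicHeat.psi (n + 1) t) = -CyclicHeat.psiTilde n t ∧
      CyclicHeat.psiTilde n t ∈ CyclicHeat.oneSubCyc n) := by
  refine ⟨fun n t ht => ?_, fun n t ht =>
    ⟨CyclicHeat.hochschild_psi n ht, CyclicHeat.psiTilde_mem_oneSubCyc n ht⟩⟩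
  have hF := fun n => CyclicHeat.heatChains_le_F n ht (CyclicHeat.psi_mem_heatChains n t)
  rcases n with _ | n
  · exact hF 0
  · refine ⟨hF (n + 1), ?_⟩
    rw [CyclicHeat.hochschild_psi n ht.le]
    exact Submodule.neg_mem _ (CyclicHeat.psiTilde_mem_oneSubCyc n ht.le)
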